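/- **Theorem 4.3.** Let $P^+(4)=\mathbb C[t,t^{-1}][\tau]\otimes\Lambda(\xi_1,\xi_2,\eta_1,\eta_2)$ be the Poisson superalgebra of (symbols of) differential operators on $S^{1|2}$, where $t,\tau$ are even, $\xi_i,\eta_i$ are odd generators of a Grassmann algebra, and $$\{A,B\}=\partial_\tau A\,\partial_tB-\partial_tA\,\partial_\tau B+(-1)^{p(A)+1}\sum_{i=1}^2\bigl(\partial_{\xi_i}A\,\partial_{\eta_i}B+\partial_{\eta_i}A\,\partial_{\xi_i}B\bigr)$$ (left derivatives). For $\alpha\in\mathbb C$ let $\Gamma_\alpha\subset P^+(4)$ be the linear span of $$E^1_\alpha=t^2,\quad F^1_\alpha=\tau^2-2\alpha t^{-2}\xi_1\xi_2\eta_1\eta_2,\quad H^1_\alpha=t\tau,$$ $$E^2_\alpha=\xi_1\xi_2,\quad F^2_\alpha=\eta_1\eta_2,\quad H^2_\alpha=\xi_1\eta_1+\xi_2\eta_2,\quad E^3_\alpha=\xi_1\eta_2,\quad F^3_\alpha=\xi_2\eta_1,\quad H^3_\alpha=\xi_1\eta_1-\xi_2\eta_2,$$ $$T^1_\alpha=t\eta_1,\quad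 T^2_\alpha=t\eta_2,\quad T^3_\alpha=t\xi_1,\quad T^4_\alpha=t\xi_2,$$ $$D^1_\alpha=\tau\xi_1+\alpha t^{-1}\xi_1\xi_2\eta_2,\quad D^2_\alpha=\tau\xi_2-\alpha t^{-1}\xi_1\xi_2\eta_1,\quad D^3_\alpha=\tau\eta_1+\alpha t^{-1}\xi_2\eta_1\eta_2,\quad D^4_\alpha=\tau\eta_2-\alpha t^{-1}\xi_1\eta_1\eta_2.$$ These 17 elements form a basis of $\Gamma_\alpha$, and $\Gamma_\alpha$ is a subsuperalgebra of $P^+(4)$; let $\rho_\alpha:\Gamma_\alpha\to P^+(4)$ be the inclusion. Let $\theta_1:\Gamma_\alpha\to P^+(4)$ be the linear map with $$\theta_1(D^1_\alpha)=t^{-1}\xi_1,\quad\theta_1(D^2_\alpha)=t^{-1}\xi_2,\quad\theta_1(D^3_\alpha)=t^{-1}\eta_1,\quad\theta_1(D^4_\alpha)=t^{-1}\eta_2,\quad\theta_1(F^1_\alpha)=2t^{-1}\tau,\quad\theta_1(H^1_\alpha)=1,$$ and $\theta_1=0$ on the other basis elements, and let $\rho_2:\Gamma_\alpha\to P^+(4)$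 be the linear map with $\rho_2(F^1_\alpha)=t^{-2}$ and $\rho_2=0$ on the other basis elements. Then, for every $\alpha\in\mathbb C$: 1. $\theta_1$ is a 1-cocycle, $\dim H^1(\Gamma_\alpha,P^+(4))=1$ (the whole cohomology superspace, even and odd classes together), and $H^1(\Gamma_\alpha,P^+(4))$ is spanned by the class of $\theta_1$. 2. The infinitesimal deformation $\rho_\alpha+\beta\theta_1$ integrates to the formal deformation $\tilde\rho_{\alpha,\beta}=\rho_\alpha+\beta\theta_1+\beta^2\rho_2$ of $\rho_\alpha$: the maps $\rho_\alpha$, $\theta_1$, $\rho_2$ are even and $\tilde\rho_{\alpha,\beta}(\{X,Y\})=\{\tilde\rho_{\alpha,\beta}(X),\tilde\rho_{\alpha,\beta}(Y)\}$ for all $X,Y\in\Gamma_\alpha$, as an identity of polynomials in the formal parameter $\beta$. -/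

import Mathlib

open scoped TensorProduct

noncomputable section

/-- The commutative algebra `P⁺ = ℂ[t, t⁻¹][τ]` of symbols of differential operators on the circle;
the monomial `t ^ i τ ^ j` (with `i : ℤ`, `j : ℕ`) is `AddMonoidAlgebra.single (i, j) 1`. -/
abbrev Symb : Type := AddMonoidAlgebra ℂ (ℤ × ℕ)

/-- The partial derivative `∂_t` on `P⁺`. -/
def symbDt : Symb →ₗ[ℂ] Symb :=
  (AddMonoidAlgebra.basis (ℤ × ℕ) ℂ).constr ℂ
    fun x => AddMonoidAlgebra.single (x.1 - 1, x.2) (x.1 : ℂ)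

/-- The partial derivative `∂_τ` on `P⁺`. -/
def symbDtau : Symb →ₗ[ℂ] Symb :=
  (AddMonoidAlgebra.basis (ℤ × ℕ) ℂ).constr ℂ
    fun x => AddMonoidAlgebra.single (x.1, x.2 - 1) (x.2 : ℂ)

/-- The Grassmann algebra `Λ(4)` in the odd variables `ξ₁, ξ₂, η₁, η₂`. -/
abbrev Grass : Type := ExteriorAlgebra ℂ (Fin 4 → ℂ)

/-- The odd variable `ξ_{i+1}`. -/
def xi (i : Fin 2) : Grass := ExteriorAlgebra.ι ℂ (Pi.single (Fin.castAdd 2 i) 1)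

/-- The odd variable `η_{i+1}`. -/
def eta (i : Fin 2) : Grass := ExteriorAlgebra.ι ℂ (Pi.single (Fin.natAdd 2 i) 1)

/-- The left partial derivative of `Λ(4)` in the `k`-th odd variable (`ξ₁, ξ₂, η₁, η₂` in this
order): the odd superderivation which is `1` on that variable and `0` on the others. -/
def grassD (k : Fin 4) : Grass →ₗ[ℂ] Grass :=
  CliffordAlgebra.contractLeft (Q := (0 : QuadraticForm ℂ (Fin 4 → ℂ))) (LinearMap.proj k)

/-- The Poisson superalgebra `P⁺(4) = P⁺ ⊗ Λ(4)` of differential operators on `S^{1|2}`. -/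
def PPlus : Type := Symb ⊗[ℂ] Grass

instance : AddCommGroup PPlus := inferInstanceAs (AddCommGroup (Symb ⊗[ℂ] Grass))

instance : Module ℂ PPlus := inferInstanceAs (Module ℂ (Symb ⊗[ℂ] Grass))

namespace PPlus

/-- The element `t ^ i τ ^ j w` of `P⁺(4)`. -/
def el (i : ℤ) (j : ℕ) (w : Grass) : PPlus := AddMonoidAlgebra.single (i, j) 1 ⊗ₜ[ℂ] w

def dt : PPlus →ₗ[ℂ] PPlus := symbDt.rTensor Grass

def dtau : PPlus →ₗ[ℂ] PPlus := symbDtau.rTensor Grass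

def dxi (i : Fin 2) : PPlus →ₗ[ℂ] PPlus := (grassD (Fin.castAdd 2 i)).lTensor Symb

def deta (i : Fin 2) : PPlus →ₗ[ℂ] PPlus := (grassD (Fin.natAdd 2 i)).lTensor Symb

/-- The associative product of `P⁺(4)`, `(a ⊗ v) (b ⊗ w) = a b ⊗ v w`. -/
def mul : PPlus →ₗ[ℂ] PPlus →ₗ[ℂ] PPlus := LinearMap.mul ℂ (Symb ⊗[ℂ] Grass)

/-- The parity automorphism `A ↦ (-1) ^ p(A) A`. -/
def parityAut : PPlus →ₗ[ℂ] PPlus :=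
  (CliffordAlgebra.involute (Q := (0 : QuadraticForm ℂ (Fin 4 → ℂ)))).toLinearMap.lTensor Symb

/-- The subspace of elements of parity `s`. -/
def ofParity (s : ZMod 2) : Submodule ℂ PPlus :=
  Module.End.eigenspace parityAut ((-1) ^ s.val)

/-- The Poisson superbracket
`{A, B} = ∂_τ A ∂_t B - ∂_t A ∂_τ B + (-1) ^ (p(A) + 1) ∑ᵢ (∂_ξᵢ A ∂_ηᵢ B + ∂_ηᵢ A ∂_ξᵢ B)`. -/
def bracket : PPlus →ₗ[ℂ] PPlus →ₗ[ℂ] PPlus :=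
  mul.compl₁₂ dtau dt - mul.compl₁₂ dt dtau
    - ∑ i : Fin 2, (mul.compl₁₂ (dxi i ∘ₗ parityAut) (deta i)
      + mul.compl₁₂ (deta i ∘ₗ parityAut) (dxi i))

end PPlus

open PPlus

/-- Labels of the 17 spanning elements of `Γ_α`. -/
inductive Gen : Type
  | E1 | F1 | H1 | E2 | F2 | H2 | E3 | F3 | H3
  | T1 | T2 | T3 | T4 | D1 | D2 | D3 | D4
  deriving DecidableEq

/-- The elements spanning `Γ_α`. -/
def gen (α : ℂ) : Gen → PPlus
  | .E1 => el 2 0 1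
  | .F1 => el 0 2 1 - (2 * α) • el (-2) 0 (xi 0 * xi 1 * eta 0 * eta 1)
  | .H1 => el 1 1 1
  | .E2 => el 0 0 (xi 0 * xi 1)
  | .F2 => el 0 0 (eta 0 * eta 1)
  | .H2 => el 0 0 (xi 0 * eta 0) + el 0 0 (xi 1 * eta 1)
  | .E3 => el 0 0 (xi 0 * eta 1)
  | .F3 => el 0 0 (xi 1 * eta 0)
  | .H3 => el 0 0 (xi 0 * eta 0) - el 0 0 (xi 1 * eta 1)
  | .T1 => el 1 0 (eta 0)
  | .T2 => el 1 0 (eta 1)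
  | .T3 => el 1 0 (xi 0)
  | .T4 => el 1 0 (xi 1)
  | .D1 => el 0 1 (xi 0) + α • el (-1) 0 (xi 0 * xi 1 * eta 1)
  | .D2 => el 0 1 (xi 1) - α • el (-1) 0 (xi 0 * xi 1 * eta 0)
  | .D3 => el 0 1 (eta 0) + α • el (-1) 0 (xi 1 * eta 0 * eta 1)
  | .D4 => el 0 1 (eta 1) - α • el (-1) 0 (xi 0 * eta 0 * eta 1)

/-- `Γ_α`, the span of these elements in `P⁺(4)`; the embedding `ρ_α` is the inclusion. -/
def Gam (α : ℂ) : Submodule ℂ PPlus := Submodule.span ℂ (Set.range (gen α))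

/-- A subspace of `P⁺(4)` is a subsuperalgebra if it is graded by parity (that is, stable under the
parity automorphism) and closed under the Poisson superbracket. -/
def IsSubsuperalgebra (L : Submodule ℂ PPlus) : Prop :=
  (∀ A ∈ L, parityAut A ∈ L) ∧ ∀ A ∈ L, ∀ B ∈ L, bracket A B ∈ L

section Cohomology

variable {L : Submodule ℂ PPlus}

/-- The bracket of a subsuperalgebra of `P⁺(4)`. -/
def subBracket (hL : IsSubsuperalgebra L) (X Y : L) : L :=
  ⟨bracket X Y, hL.2 X X.2 Y Y.2⟩

/-- The 1-cochains `c : L → P⁺(4)` of parity `s`. -/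
def cochains (L : Submodule ℂ PPlus) (s : ZMod 2) : Submodule ℂ (L →ₗ[ℂ] PPlus) where
  carrier := {c | ∀ (i : ZMod 2) (X : L), (X : PPlus) ∈ ofParity i → c X ∈ ofParity (i + s)}
  add_mem' hc hc' i X hX := add_mem (hc i X hX) (hc' i X hX)
  zero_mem' _ _ _ := zero_mem _
  smul_mem' r _ hc i X hX := Submodule.smul_mem _ r (hc i X hX)

/-- The 1-cocycles of parity `s`: the cochains `c` of parity `s` such that for homogeneous `X`, `Y`
`dc(X, Y) = (-1) ^ (p(X) s) {X, c(Y)} - (-1) ^ (p(Y) (p(X) + s)) {Y, c(X)} - c({X, Y})` vanishes. -/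
def cocyclesOfParity (hL : IsSubsuperalgebra L) (s : ZMod 2) : Submodule ℂ (L →ₗ[ℂ] PPlus) where
  carrier := {c | c ∈ cochains L s ∧ ∀ (i j : ZMod 2) (X Y : L),
    (X : PPlus) ∈ ofParity i → (Y : PPlus) ∈ ofParity j →
      (-1 : ℂ) ^ (i * s).val • bracket X (c Y) - (-1 : ℂ) ^ (j * (i + s)).val • bracket Y (c X)
        - c (subBracket hL X Y) = 0}
  add_mem' {c c'} hc hc' := ⟨add_mem hc.1 hc'.1, fun i j X Y hX hY => by
    have h := congrArg₂ (· + ·) (hc.2 i j X Y hX hY) (hc'.2 i j X Y hX hY)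
    simp only [add_zero] at h
    rw [← h]
    simp only [LinearMap.add_apply, map_add, smul_add]
    abel⟩
  zero_mem' := ⟨zero_mem _, fun i j X Y _ _ => by simp⟩
  smul_mem' r c hc := ⟨Submodule.smul_mem _ r hc.1, fun i j X Y hX hY => by
    have h := congrArg (r • ·) (hc.2 i j X Y hX hY)
    simp only [smul_zero] at h
    rw [← h]
    simp only [LinearMap.smul_apply, map_smul, smul_sub, smul_comm r]⟩

/-- The 1-coboundaries of parity `s`: the maps `du` with `(du)(X) = (-1) ^ (p(X) s) {X, u}` for
homogeneous `X`, where `u` has parity `s`. -/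
def coboundariesOfParity (L : Submodule ℂ PPlus) (s : ZMod 2) : Submodule ℂ (L →ₗ[ℂ] PPlus) where
  carrier := {c | ∃ u ∈ ofParity s, ∀ (i : ZMod 2) (X : L), (X : PPlus) ∈ ofParity i →
    c X = (-1 : ℂ) ^ (i * s).val • bracket X u}
  add_mem' := by
    rintro c c' ⟨u, hu, h⟩ ⟨u', hu', h'⟩
    refine ⟨u + u', add_mem hu hu', fun i X hX => ?_⟩
    rw [LinearMap.add_apply, h i X hX, h' i X hX, map_add, smul_add]
  zero_mem' := ⟨0, zero_mem _, fun i X _ => by simp⟩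
  smul_mem' := by
    rintro r c ⟨u, hu, h⟩
    refine ⟨r • u, Submodule.smul_mem _ r hu, fun i X hX => ?_⟩
    rw [LinearMap.smul_apply, h i X hX, map_smul, smul_comm]

/-- `Z¹(L, P⁺(4))`, the sum of its even and its odd part. -/
def cocycles (hL : IsSubsuperalgebra L) : Submodule ℂ (L →ₗ[ℂ] PPlus) :=
  cocyclesOfParity hL 0 ⊔ cocyclesOfParity hL 1

/-- `B¹(L, P⁺(4))`, the sum of its even and its odd part. -/
def coboundaries (L : Submodule ℂ PPlus) : Submodule ℂ (L →ₗ[ℂ] PPlus) :=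
  coboundariesOfParity L 0 ⊔ coboundariesOfParity L 1

/-- The first cohomology space `H¹(L, P⁺(4)) = Z¹ / B¹` (even and odd classes). -/
abbrev H1 (hL : IsSubsuperalgebra L) : Type :=
  cocycles hL ⧸ (coboundaries L).submoduleOf (cocycles hL)

/-- The cohomology class of a 1-cocycle. -/
def H1.mk (hL : IsSubsuperalgebra L) (c : L →ₗ[ℂ] PPlus) (hc : c ∈ cocycles hL) : H1 hL :=
  Submodule.Quotient.mk ⟨c, hc⟩

/-- The formal power series `∑ₖ βᵏ rₖ` is a formal deformation of the inclusion `L → P⁺(4)`: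
`r₀` is the inclusion, every `rₖ` is an even linear map, and
`(∑ₖ βᵏ rₖ) [X, Y] = {(∑ₖ βᵏ rₖ) X, (∑ₖ βᵏ rₖ) Y}` coefficientwise in `β`. -/
def IsFormalDeformation (hL : IsSubsuperalgebra L) (r : ℕ → (L →ₗ[ℂ] PPlus)) : Prop :=
  r 0 = L.subtype ∧ (∀ k, r k ∈ cochains L 0) ∧
    ∀ (X Y : L) (n : ℕ), r n (subBracket hL X Y) =
      ∑ p ∈ Finset.HasAntidiagonal.antidiagonal n, bracket (r p.1 X) (r p.2 Y)

end Cohomology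

/-- The values of `θ₁` on the spanning elements of `Γ_α`. -/
def theta1Val : Gen → PPlus
  | .D1 => el (-1) 0 (xi 0)
  | .D2 => el (-1) 0 (xi 1)
  | .D3 => el (-1) 0 (eta 0)
  | .D4 => el (-1) 0 (eta 1)
  | .F1 => (2 : ℂ) • el (-1) 1 1
  | .H1 => el 0 0 1
  | _ => 0

/-- The values of `ρ₂` on the spanning elements of `Γ_α`. -/
def rho2Val : Gen → PPlus
  | .F1 => el (-2) 0 1
  | _ => 0

/-- The coefficients of the polynomial `r₀ + β r₁ + β² r₂`. -/
def quadraticSeries {L : Submodule ℂ PPlus} (r₀ r₁ r₂ : L →ₗ[ℂ] PPlus) : ℕ → (L →ₗ[ℂ] PPlus)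
  | 0 => r₀
  | 1 => r₁
  | 2 => r₂
  | _ => 0

end

open PPlus

/-! The function `log t` is not in `P⁺(4)`, but `D = {·, log t} = t⁻¹ ∂_τ` (`logDer`) is an even
derivation of `P⁺(4)`, and `θ₁` is its restriction to `Γ_α`. Moreover `ρ₂ = D² / 2` and `D³ = 0` on
`Γ_α`, so the deformation is `exp (β D)` restricted to `Γ_α`, that is, the substitution `τ ↦ τ + β
t⁻¹`; this is why it is multiplicative. The class of `θ₁` is nonzero because `{t τ, u}` never has a
constant term, while `θ₁ (t τ) = 1`.

For the upper bound (`IsGenCocycle.exists_eq`) a cocycle `f` is normalized on the generators. Since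
`ad t² = -2 t ∂_τ` is onto, a coboundary makes `f (t²) = 0`, and then `f (t τ)` is free of `τ`.
Since `t τ` multiplies `tᵏ w` by `k`, another coboundary reduces `f (t τ)` to some `w ∈ Λ(4)`. The
relations between `t τ` and the `t xₖ` force every `∂ₖ w` to vanish, so `w` is a scalar `κ`, and
subtracting `κ θ₁` removes it. What remains on the elements `t xₖ` is a closed family of elements of
`Λ(4)`, which is exact by a Poincaré lemma; a third coboundary kills it.

The normalized cocycle vanishes (`IsGenCocycle.eq_zero`). An element commuting with `t²` and all `t
xₖ` and of weight `n` under `t τ` is a multiple of `tⁿ`. This leaves a scalar for each remaining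
generator, and relations in `Γ_α` valid for every `α` kill it.

Even and odd cocycles are treated together: composing an odd cocycle with the parity automorphism
removes the signs that depend on its parity. -/

theorem zmodTwo_cases (i : ZMod 2) : i = 0 ∨ i = 1 := by
  revert i; decide

theorem zmodTwo_val_one : (1 : ZMod 2).val = 1 := rfl

theorem zmodTwo_one_add_one : (1 : ZMod 2) + 1 = 0 := rfl

/-! ### The Grassmann algebra as a Poisson superalgebra -/

namespace Grass

/-- The four odd variables `ξ₁, ξ₂, η₁, η₂`. -/
noncomputable def x (k : Fin 4) : Grass := ExteriorAlgebra.ι ℂ (Pi.single k 1)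

/-- The parity automorphism of the Grassmann algebra. -/
noncomputable def inv : Grass →ₐ[ℂ] Grass :=
  CliffordAlgebra.involute (Q := (0 : QuadraticForm ℂ (Fin 4 → ℂ)))

/-- Left multiplication by the variables generates everything from `1`, so signs can be followed one
variable at a time without a basis of monomials. -/
theorem induction {C : Grass → Prop} (one : C 1) (x_mul : ∀ k w, C w → C (x k * w))
    (add : ∀ v w, C v → C w → C (v + w)) (smul : ∀ (r : ℂ) w, C w → C (r • w)) (w : Grass) :
    C w := by
  have key : ∀ v : Grass, ∀ w, C w → C (v * w) := by
    intro v
    induction v using ExteriorAlgebra.induction with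
    | algebraMap r => intro w hw; rw [← Algebra.smul_def]; exact smul r w hw
    | ι m =>
      intro w hw
      have hm : ExteriorAlgebra.ι ℂ m = ∑ k, m k • x k := by
        simp only [x, ← map_smul, ← map_sum]
        congr 1
        ext i
        simp [Finset.sum_apply, Pi.single_apply]
      rw [hm, Fin.sum_univ_four]
      simp only [add_mul, smul_mul_assoc]
      exact add _ _ (add _ _ (add _ _ (smul _ _ (x_mul _ _ hw)) (smul _ _ (x_mul _ _ hw)))
        (smul _ _ (x_mul _ _ hw))) (smul _ _ (x_mul _ _ hw))
    | mul a b ha hb => intro w hw; rw [mul_assoc]; exact ha _ (hb _ hw)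
    | add a b ha hb => intro w hw; rw [add_mul]; exact add _ _ (ha _ hw) (hb _ hw)
  simpa using key w 1 one

@[simp] theorem inv_x (k : Fin 4) : inv (x k) = -x k := CliffordAlgebra.involute_ι _

@[simp] theorem inv_inv (w : Grass) : inv (inv w) = w := CliffordAlgebra.involute_involute _

theorem x_sq (k : Fin 4) : x k * x k = 0 := ExteriorAlgebra.ι_sq_zero _

theorem x_sq_mul (k : Fin 4) (w : Grass) : x k * (x k * w) = 0 := by
  rw [← mul_assoc, x_sq, zero_mul]

theorem x_mul_x (k l : Fin 4) : x k * x l = -(x l * x k) :=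
  eq_neg_of_add_eq_zero_left (ExteriorAlgebra.ι_add_mul_swap _ _)

theorem x_mul_x_mul (k l : Fin 4) (w : Grass) : x k * (x l * w) = -(x l * (x k * w)) := by
  rw [← mul_assoc, x_mul_x, neg_mul, mul_assoc]

@[simp] theorem grassD_one (k : Fin 4) : grassD k 1 = 0 :=
  CliffordAlgebra.contractLeft_one (Q := 0) _

theorem grassD_x_mul (k l : Fin 4) (w : Grass) :
    grassD k (x l * w) = (if k = l then w else 0) - x l * grassD k w := by
  have h := CliffordAlgebra.contractLeft_ι_mul (Q := (0 : QuadraticForm ℂ (Fin 4 → ℂ)))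
    (d := LinearMap.proj k) (Pi.single l 1) w
  refine h.trans ?_
  simp only [LinearMap.proj_apply, Pi.single_apply, ite_smul, one_smul, zero_smul]
  rfl

theorem grassD_x (k l : Fin 4) : grassD k (x l) = if k = l then 1 else 0 := by
  simpa using grassD_x_mul k l 1

theorem grassD_comm (k l : Fin 4) (w : Grass) : grassD k (grassD l w) = -grassD l (grassD k w) :=
  CliffordAlgebra.contractLeft_comm (Q := 0) _ _ _

theorem grassD_grassD (k : Fin 4) (w : Grass) : grassD k (grassD k w) = 0 :=
  CliffordAlgebra.contractLeft_contractLeft (Q := 0) _ _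

theorem grassD_inv (k : Fin 4) (w : Grass) : grassD k (inv w) = -inv (grassD k w) := by
  induction w using Grass.induction with
  | one => simp
  | x_mul l w ih =>
    simp only [map_mul, inv_x, neg_mul, map_neg, grassD_x_mul, ih, map_sub]
    split_ifs <;> simp
  | add v w hv hw => simp only [map_add, hv, hw, neg_add]
  | smul r w hw => simp only [map_smul, hw, smul_neg]

theorem grassD_mul (k : Fin 4) (v w : Grass) :
    grassD k (v * w) = grassD k v * w + inv v * grassD k w := by
  induction v using Grass.induction with
  | one => simp
  | x_mul l v ih =>
    simp only [mul_assoc, grassD_x_mul, ih, map_mul, inv_x, sub_mul, ite_mul, zero_mul, mul_add,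
      neg_mul]
    abel
  | add v v' hv hv' => simp only [add_mul, map_add, hv, hv']; abel
  | smul r v hv => simp only [smul_mul_assoc, map_smul, hv, smul_add]

theorem x_mul_eq (k : Fin 4) (w : Grass) : x k * w = inv w * x k := by
  induction w using Grass.induction with
  | one => simp
  | x_mul l w ih => rw [x_mul_x_mul, ih, map_mul, inv_x, neg_mul, neg_mul, mul_assoc]
  | add v w hv hw => simp only [mul_add, map_add, hv, hw, add_mul]
  | smul r w hw => simp only [mul_smul_comm, map_smul, hw, smul_mul_assoc]

theorem even_mul_comm {v : Grass} (hv : inv v = v) (w : Grass) : v * w = w * v := by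
  induction w using Grass.induction with
  | one => simp
  | x_mul l w ih => rw [mul_assoc, ← ih, ← mul_assoc, ← mul_assoc, x_mul_eq, hv]
  | add w w' h h' => simp only [mul_add, add_mul, h, h']
  | smul r w h => simp only [mul_smul_comm, smul_mul_assoc, h]

theorem odd_mul_comm {v : Grass} (hv : inv v = -v) (w : Grass) : v * w = inv w * v := by
  induction w using Grass.induction with
  | one => simp
  | x_mul l w ih =>
    rw [map_mul, mul_assoc, ← ih, ← mul_assoc, ← mul_assoc, inv_x, neg_mul, x_mul_eq, hv, neg_mul,
      neg_mul, neg_mul, neg_neg]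
  | add w w' h h' => simp only [mul_add, map_add, add_mul, h, h']
  | smul r w h => simp only [mul_smul_comm, map_smul, smul_mul_assoc, h]

/-- Supercommutativity of the Grassmann algebra. -/
theorem mul_comm_of_parity {i j : ZMod 2} {v w : Grass} (hv : inv v = (-1 : ℂ) ^ i.val • v)
    (hw : inv w = (-1 : ℂ) ^ j.val • w) : v * w = (-1 : ℂ) ^ (i * j).val • (w * v) := by
  obtain rfl | rfl := zmodTwo_cases i
  · have hv' : inv v = v := by simpa using hv
    simpa using even_mul_comm hv' w
  · have hv' : inv v = -v := by simpa [zmodTwo_val_one] using hv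
    rw [odd_mul_comm hv', hw, one_mul, smul_mul_assoc]

/-- The bracket `∑ₖ ∂ₖ(σ v) ∂ₖ₊₂ w` of the Grassmann algebra, `σ` being the parity automorphism. -/
noncomputable def br : Grass →ₗ[ℂ] Grass →ₗ[ℂ] Grass :=
  ∑ k : Fin 4, (LinearMap.mul ℂ Grass).compl₁₂ (grassD k ∘ₗ inv.toLinearMap) (grassD (k + 2))

theorem br_apply (v w : Grass) : br v w = ∑ k, grassD k (inv v) * grassD (k + 2) w := by
  simp [br, LinearMap.sum_apply]

theorem inv_br (v w : Grass) : inv (br v w) = br (inv v) (inv w) := by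
  simp only [br_apply, map_sum, map_mul, grassD_inv, map_neg, inv_inv, mul_neg, neg_mul]

/-- On the indices of `ξ₁, ξ₂, η₁, η₂`, the map `k ↦ k + 2` is the involution exchanging `ξᵢ` and
`ηᵢ`. -/
theorem sum_add_two {M : Type*} [AddCommMonoid M] (f : Fin 4 → Fin 4 → M) :
    ∑ k, f k (k + 2) = ∑ k, f (k + 2) k := by
  simp only [Fin.sum_univ_four]
  exact (add_assoc _ _ _).trans ((add_comm _ _).trans (add_assoc _ _ _).symm)

theorem inv_grassD {i : ZMod 2} {v : Grass} (hv : inv v = (-1 : ℂ) ^ i.val • v) (k : Fin 4) :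
    inv (grassD k v) = (-1 : ℂ) ^ (i + 1).val • grassD k v := by
  rw [← neg_neg (inv (grassD k v)), ← grassD_inv, hv, map_smul]
  obtain rfl | rfl := zmodTwo_cases i <;> simp [zmodTwo_val_one, zmodTwo_one_add_one]

theorem br_antisymm {i j : ZMod 2} {v w : Grass} (hv : inv v = (-1 : ℂ) ^ i.val • v)
    (hw : inv w = (-1 : ℂ) ^ j.val • w) : br v w = -(-1 : ℂ) ^ (i * j).val • br w v := by
  simp only [br_apply, hv, hw]
  rw [← sum_add_two (fun k l => grassD l ((-1 : ℂ) ^ j.val • w) * grassD k v), Finset.smul_sum]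
  refine Finset.sum_congr rfl fun k _ => ?_
  rw [map_smul, map_smul, smul_mul_assoc, smul_mul_assoc,
    mul_comm_of_parity (inv_grassD hv k) (inv_grassD hw (k + 2)), smul_smul, smul_smul]
  congr 1
  obtain rfl | rfl := zmodTwo_cases i <;> obtain rfl | rfl := zmodTwo_cases j <;>
    simp [zmodTwo_val_one, zmodTwo_one_add_one]

theorem br_leibniz {i j : ZMod 2} {u v : Grass} (hu : inv u = (-1 : ℂ) ^ i.val • u)
    (hv : inv v = (-1 : ℂ) ^ j.val • v) (w : Grass) :
    br u (v * w) = br u v * w + (-1 : ℂ) ^ (i * j).val • (v * br u w) := by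
  simp only [br_apply, grassD_mul, mul_add, Finset.sum_add_distrib, Finset.sum_mul, Finset.mul_sum,
    Finset.smul_sum, mul_assoc]
  congr 1
  refine Finset.sum_congr rfl fun k _ => ?_
  rw [hu, hv, map_smul, ← mul_assoc, ← mul_assoc, smul_mul_smul_comm,
    mul_comm_of_parity (inv_grassD hu k) hv]
  simp only [mul_smul_comm, smul_mul_assoc, smul_smul]
  congr 1
  obtain rfl | rfl := zmodTwo_cases i <;> obtain rfl | rfl := zmodTwo_cases j <;>
    simp [zmodTwo_val_one, zmodTwo_one_add_one]

theorem mul_br {i j : ZMod 2} {u v : Grass} (hu : inv u = (-1 : ℂ) ^ i.val • u)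
    (hv : inv v = (-1 : ℂ) ^ j.val • v) (w : Grass) :
    br (u * v) w = u * br v w + (-1 : ℂ) ^ (i * j).val • (v * br u w) := by
  simp only [br_apply, map_mul, grassD_mul, add_mul, Finset.sum_add_distrib, Finset.mul_sum,
    Finset.smul_sum, inv_inv, mul_assoc]
  rw [add_comm]
  congr 1
  refine Finset.sum_congr rfl fun k _ => ?_
  rw [hu, hv, map_smul, ← mul_assoc, ← mul_assoc, smul_mul_smul_comm,
    mul_comm_of_parity (inv_grassD hu k) hv]
  simp only [mul_smul_comm, smul_mul_assoc, smul_smul]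
  congr 1
  obtain rfl | rfl := zmodTwo_cases i <;> obtain rfl | rfl := zmodTwo_cases j <;>
    simp [zmodTwo_val_one, zmodTwo_one_add_one]

/-- Expanding gives terms with a second derivative of `u`, `v` or `w`. Those of `v` (`h₁`) and `w`
(`h₃`) agree on both sides, and those of `u` (`h₂`) cancel on the right. -/
theorem br_jacobi {i j : ZMod 2} {u v : Grass} (hu : inv u = (-1 : ℂ) ^ i.val • u)
    (hv : inv v = (-1 : ℂ) ^ j.val • v) (w : Grass) :
    br u (br v w) = br (br u v) w + (-1 : ℂ) ^ (i * j).val • br v (br u w) := by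
  rw [br_apply u (br v w), br_apply v w, br_apply (br u v) w, br_apply u v, br_apply v (br u w),
    br_apply u w]
  simp only [map_sum, grassD_mul, map_mul, Finset.mul_sum, Finset.sum_mul, mul_add,
    add_mul, Finset.sum_add_distrib, Finset.smul_sum, smul_add]
  have h₁ : ∑ l, ∑ k, inv (inv (grassD k (inv u))) * grassD l (inv (grassD (k + 2) v)) *
        grassD (l + 2) w
      = ∑ k, ∑ l, grassD k (inv u) * (grassD (k + 2) (grassD l (inv v)) * grassD (l + 2) w) := by
    rw [Finset.sum_comm]
    refine Finset.sum_congr rfl fun k _ => Finset.sum_congr rfl fun l _ => ?_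
    rw [inv_inv, grassD_comm (k + 2), grassD_inv (k + 2), map_neg, neg_neg, mul_assoc]
  have h₂ : ∑ l, ∑ k, grassD l (inv (grassD k (inv u))) * inv (grassD (k + 2) v) *
        grassD (l + 2) w
      = -∑ k, ∑ l, (-1 : ℂ) ^ (i * j).val • (grassD k (inv v) *
          (grassD (k + 2) (grassD l (inv u)) * grassD (l + 2) w)) := by
    rw [Finset.sum_comm, sum_add_two (fun k m => ∑ l, grassD l (inv (grassD k (inv u))) *
      inv (grassD m v) * grassD (l + 2) w), ← Finset.sum_neg_distrib]
    refine Finset.sum_congr rfl fun k _ => ?_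
    rw [← Finset.sum_neg_distrib]
    refine Finset.sum_congr rfl fun l _ => ?_
    have h := mul_comm_of_parity (inv_grassD (inv_grassD hu l) (k + 2)) (inv_grassD hv k)
    rw [← neg_neg (inv (grassD (k + 2) (inv u))), ← grassD_inv, inv_inv, map_neg, grassD_comm l,
      neg_neg, ← mul_assoc (grassD k (inv v)), hu, hv, inv_grassD hv]
    simp only [map_smul, mul_smul_comm, smul_mul_assoc, h, smul_smul, ← neg_smul]
    congr 1
    obtain rfl | rfl := zmodTwo_cases i <;> obtain rfl | rfl := zmodTwo_cases j <;>
      simp [zmodTwo_val_one, zmodTwo_one_add_one]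
  have h₃ : ∑ k, ∑ l, grassD k (inv u) *
        (inv (grassD l (inv v)) * grassD (k + 2) (grassD (l + 2) w))
      = ∑ k, ∑ l, (-1 : ℂ) ^ (i * j).val • (grassD k (inv v) *
          (inv (grassD l (inv u)) * grassD (k + 2) (grassD (l + 2) w))) := by
    rw [Finset.sum_comm]
    refine Finset.sum_congr rfl fun l _ => Finset.sum_congr rfl fun k _ => ?_
    have h := mul_comm_of_parity (inv_grassD hu k) (inv_grassD hv l)
    rw [hu, hv, grassD_comm (k + 2)]
    simp only [map_smul, inv_grassD hu, inv_grassD hv, mul_smul_comm, smul_mul_assoc, smul_smul,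
      mul_neg, ← mul_assoc, h, ← neg_smul]
    congr 1
    obtain rfl | rfl := zmodTwo_cases i <;> obtain rfl | rfl := zmodTwo_cases j <;>
      simp [zmodTwo_val_one, zmodTwo_one_add_one]
  rw [h₁, h₂, h₃]
  abel

/-- An element annihilated by all odd derivatives is a scalar. -/
theorem eq_algebraMap_of_grassD_eq_zero {w : Grass} (hw : ∀ k, grassD k w = 0) :
    w = algebraMap ℂ Grass (ExteriorAlgebra.algebraMapInv w) := by
  -- Multiplication by the top monomial sees only the constant term. If all derivatives of `w`
  -- vanish, differentiating the product four times returns `w` itself.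
  have h₁ : ∀ v : Grass, x 0 * (x 1 * (x 2 * (x 3 * v))) =
      ExteriorAlgebra.algebraMapInv v • (x 0 * (x 1 * (x 2 * x 3))) := by
    intro v
    induction v using Grass.induction with
    | one => simp
    | x_mul k v _ =>
      have h0 : ExteriorAlgebra.algebraMapInv (x k * v) = (0 : ℂ) := by
        simp [ExteriorAlgebra.algebraMapInv, x]
      rw [h0, zero_smul]
      fin_cases k
      · simp [x_mul_x_mul 3 0, x_mul_x_mul 2 0, x_mul_x_mul 1 0, x_sq_mul]
      · simp [x_mul_x_mul 3 1, x_mul_x_mul 2 1, x_sq_mul]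
      · simp [x_mul_x_mul 3 2, x_sq_mul]
      · simp [x_sq_mul]
    | add v v' h h' => simp only [mul_add, h, h', map_add, add_smul]
    | smul r v h => simp only [mul_smul_comm, h, map_smul, smul_eq_mul, mul_smul]
  have h₂ := congrArg (fun v => grassD 3 (grassD 2 (grassD 1 (grassD 0 v)))) (h₁ w)
  simpa [grassD_x_mul, hw, grassD_x, Algebra.algebraMap_eq_smul_one] using h₂

/-- The Poincaré lemma for the Grassmann algebra. -/
theorem exists_grassD_eq {v : Fin 4 → Grass}
    (hv : ∀ k l, grassD k (v l) + grassD l (v k) = 0) : ∃ u, ∀ k, grassD k u = v k := by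
  have step : ∀ (S : Finset (Fin 4)), ∃ u, ∀ k ∈ S, grassD k u = v k := by
    intro S
    induction S using Finset.induction_on with
    | empty => exact ⟨0, by simp⟩
    | insert m S _ ih =>
      obtain ⟨u, hu⟩ := ih
      -- The correction integrates the defect in the variable `m`. Closedness makes this defect
      -- independent of the variables already treated, so their derivatives are unchanged.
      refine ⟨u + x m * (v m - grassD m u), fun k hk => ?_⟩
      have hself : grassD m (v m) = 0 := by
        have h2 : (2 : ℂ) • grassD m (v m) = 0 := by rw [two_smul, hv m m]
        simpa using h2
      have hself' : grassD m (grassD m u) = 0 := grassD_grassD m u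
      rw [map_add, grassD_x_mul, map_sub]
      split_ifs with h
      · rw [h, hself, hself']; simp
      · have hk' := (Finset.mem_insert.mp hk).resolve_left h
        rw [grassD_comm k m, hu k hk', eq_neg_of_add_eq_zero_left (hv k m)]; simp
  obtain ⟨u, hu⟩ := step Finset.univ
  exact ⟨u, fun k => hu k (Finset.mem_univ k)⟩

end Grass

/-! ### The Poisson algebra of symbols on the circle -/

namespace Symb

@[simp] theorem dt_single (x : ℤ × ℕ) (r : ℂ) :
    symbDt (AddMonoidAlgebra.single x r) = AddMonoidAlgebra.single (x.1 - 1, x.2) (r * x.1) := by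
  have h : AddMonoidAlgebra.single x r = r • AddMonoidAlgebra.basis (ℤ × ℕ) ℂ x := by simp
  rw [h, map_smul, symbDt, Module.Basis.constr_basis]
  simp

@[simp] theorem dtau_single (x : ℤ × ℕ) (r : ℂ) :
    symbDtau (AddMonoidAlgebra.single x r) =
      AddMonoidAlgebra.single (x.1, x.2 - 1) (r * x.2) := by
  have h : AddMonoidAlgebra.single x r = r • AddMonoidAlgebra.basis (ℤ × ℕ) ℂ x := by simp
  rw [h, map_smul, symbDtau, Module.Basis.constr_basis]
  simp

theorem dt_mul (a b : Symb) : symbDt (a * b) = symbDt a * b + a * symbDt b := by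
  induction a using AddMonoidAlgebra.induction_linear with
  | zero => simp
  | add a a' h h' => simp only [add_mul, map_add, h, h']; abel
  | single x r =>
    induction b using AddMonoidAlgebra.induction_linear with
    | zero => simp
    | add b b' h h' => simp only [mul_add, map_add, h, h']; abel
    | single y s =>
      simp only [AddMonoidAlgebra.single_mul_single, dt_single, Prod.fst_add,
        Prod.snd_add]
      have e₁ : ((x.1 - 1, x.2) + y : ℤ × ℕ) = (x.1 + y.1 - 1, x.2 + y.2) :=
        Prod.ext (by simp; ring) rfl
      have e₂ : (x + (y.1 - 1, y.2) : ℤ × ℕ) = (x.1 + y.1 - 1, x.2 + y.2) :=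
        Prod.ext (by simp; ring) rfl
      rw [e₁, e₂, ← AddMonoidAlgebra.single_add]
      congr 1
      push_cast
      ring

theorem dtau_mul (a b : Symb) : symbDtau (a * b) = symbDtau a * b + a * symbDtau b := by
  induction a using AddMonoidAlgebra.induction_linear with
  | zero => simp
  | add a a' h h' => simp only [add_mul, map_add, h, h']; abel
  | single x r =>
    induction b using AddMonoidAlgebra.induction_linear with
    | zero => simp
    | add b b' h h' => simp only [mul_add, map_add, h, h']; abel
    | single y s =>
      obtain ⟨i, j⟩ := x
      obtain ⟨k, l⟩ := y
      simp only [AddMonoidAlgebra.single_mul_single, dtau_single, Prod.mk_add_mk]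
      rcases j with _ | j <;> rcases l with _ | l
      · simp
      · simp; ring_nf
      · simp [add_right_comm _ 1]; ring_nf
      · have e₁ : j + 1 + (l + 1) - 1 = j + 1 + l := by omega
        have e₂ : j + 1 - 1 + (l + 1) = j + 1 + l := by omega
        have e₃ : j + 1 + (l + 1 - 1) = j + 1 + l := by omega
        rw [e₁, e₂, e₃, ← AddMonoidAlgebra.single_add]
        congr 1
        push_cast
        ring

theorem dtau_dt (a : Symb) : symbDtau (symbDt a) = symbDt (symbDtau a) := by
  induction a using AddMonoidAlgebra.induction_linear with
  | zero => simp
  | add a a' h h' => simp only [map_add, h, h']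
  | single x r => simp [mul_right_comm]

/-- The Poisson bracket of `P⁺`. -/
noncomputable def br (a b : Symb) : Symb := symbDtau a * symbDt b - symbDt a * symbDtau b

theorem br_antisymm (a b : Symb) : br a b = -br b a := by
  simp only [br]; ring

theorem br_mul (a b c : Symb) : br a (b * c) = br a b * c + b * br a c := by
  simp only [br, dt_mul, dtau_mul]; ring

theorem mul_br (a b c : Symb) : br (a * b) c = a * br b c + b * br a c := by
  simp only [br, dt_mul, dtau_mul]; ring

theorem br_jacobi (a b c : Symb) : br a (br b c) = br (br a b) c + br b (br a c) := by
  simp only [br, map_sub, dt_mul, dtau_mul, dtau_dt]; ring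

end Symb

/-! ### The tensor product: parity, antisymmetry and Jacobi identity -/

namespace PPlus

/-- The element `a ⊗ w` of `P⁺(4)`. -/
noncomputable def tm (a : Symb) (w : Grass) : PPlus := a ⊗ₜ[ℂ] w

theorem el_eq_tm (i : ℤ) (j : ℕ) (w : Grass) :
    el i j w = tm (AddMonoidAlgebra.single (i, j) 1) w := rfl

theorem tm_add (a : Symb) (v w : Grass) : tm a (v + w) = tm a v + tm a w :=
  TensorProduct.tmul_add _ _ _

theorem tm_sub (a : Symb) (v w : Grass) : tm a (v - w) = tm a v - tm a w :=
  TensorProduct.tmul_sub _ _ _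

theorem tm_neg (a : Symb) (v : Grass) : tm a (-v) = -tm a v :=
  TensorProduct.tmul_neg _ _

theorem tm_smul (a : Symb) (r : ℂ) (v : Grass) : tm a (r • v) = r • tm a v :=
  TensorProduct.tmul_smul _ _ _

theorem tm_zero (a : Symb) : tm a 0 = 0 := TensorProduct.tmul_zero _ _

theorem add_tm (a b : Symb) (w : Grass) : tm (a + b) w = tm a w + tm b w :=
  TensorProduct.add_tmul _ _ _

theorem sub_tm (a b : Symb) (w : Grass) : tm (a - b) w = tm a w - tm b w :=
  TensorProduct.sub_tmul _ _ _

theorem neg_tm (a : Symb) (w : Grass) : tm (-a) w = -tm a w := TensorProduct.neg_tmul _ _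

theorem smul_tm (r : ℂ) (a : Symb) (w : Grass) : tm (r • a) w = r • tm a w :=
  TensorProduct.smul_tmul' _ _ _

theorem zero_tm (w : Grass) : tm 0 w = 0 := TensorProduct.zero_tmul _ _

theorem tm_induction {C : PPlus → Prop} (zero : C 0) (tm : ∀ a w, C (tm a w))
    (add : ∀ A B, C A → C B → C (A + B)) (A : PPlus) : C A :=
  TensorProduct.induction_on (motive := C) A zero tm add

theorem el_induction {C : PPlus → Prop} (zero : C 0) (el : ∀ i j w, C (el i j w))
    (add : ∀ A B, C A → C B → C (A + B)) (A : PPlus) : C A := by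
  induction A using tm_induction with
  | zero => exact zero
  | add A B hA hB => exact add A B hA hB
  | tm a w =>
    induction a using AddMonoidAlgebra.induction_linear with
    | zero => rw [zero_tm]; exact zero
    | add a b ha hb => rw [add_tm]; exact add _ _ ha hb
    | single x r =>
      have h : AddMonoidAlgebra.single x r = r • AddMonoidAlgebra.single (x.1, x.2) (1 : ℂ) := by
        simp
      rw [h, smul_tm, ← tm_smul]
      exact el _ _ _

theorem dt_tm (a : Symb) (w : Grass) : dt (tm a w) = tm (symbDt a) w := rfl

theorem dtau_tm (a : Symb) (w : Grass) : dtau (tm a w) = tm (symbDtau a) w := rfl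

theorem mul_tm (a b : Symb) (v w : Grass) : mul (tm a v) (tm b w) = tm (a * b) (v * w) :=
  Algebra.TensorProduct.tmul_mul_tmul _ _ _ _

theorem parityAut_tm (a : Symb) (w : Grass) : parityAut (tm a w) = tm a (Grass.inv w) := rfl

theorem dxi_tm (i : Fin 2) (a : Symb) (w : Grass) :
    dxi i (tm a w) = tm a (grassD (Fin.castAdd 2 i) w) := rfl

theorem deta_tm (i : Fin 2) (a : Symb) (w : Grass) :
    deta i (tm a w) = tm a (grassD (Fin.natAdd 2 i) w) := rfl

/-- This presents `P⁺(4)` as a tensor product of two Poisson superalgebras; its antisymmetry and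
Jacobi identity follow from those of the factors and their Leibniz rules. -/
theorem bracket_tm (a b : Symb) (v w : Grass) :
    bracket (tm a v) (tm b w) = tm (Symb.br a b) (v * w) - tm (a * b) (Grass.br v w) := by
  simp only [bracket, LinearMap.sub_apply, LinearMap.add_apply,
    LinearMap.compl₁₂_apply, LinearMap.comp_apply, dt_tm, dtau_tm, mul_tm, parityAut_tm, dxi_tm,
    deta_tm, Fin.sum_univ_two, Grass.br_apply, Fin.sum_univ_four, Symb.br, sub_tm, tm_add]
  simp only [Fin.isValue, Fin.reduceCastAdd, Fin.reduceNatAdd, Fin.reduceAdd, zero_add]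
  abel

theorem parityAut_parityAut (A : PPlus) : parityAut (parityAut A) = A := by
  induction A using tm_induction with
  | zero => simp
  | tm a w => simp [parityAut_tm]
  | add A B hA hB => simp only [map_add, hA, hB]

theorem parityAut_bracket (A B : PPlus) :
    parityAut (bracket A B) = bracket (parityAut A) (parityAut B) := by
  induction A using tm_induction with
  | zero => simp
  | add A A' h h' => simp only [map_add, LinearMap.add_apply, h, h']
  | tm a v =>
    induction B using tm_induction with
    | zero => simp
    | add B B' h h' => simp only [map_add, h, h']
    | tm b w => simp only [bracket_tm, map_sub, parityAut_tm, map_mul, Grass.inv_br]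

theorem mem_ofParity {s : ZMod 2} {A : PPlus} :
    A ∈ ofParity s ↔ parityAut A = (-1 : ℂ) ^ s.val • A := Module.End.mem_eigenspace_iff

/-- The projection to the subspace of parity `s`. -/
noncomputable def proj (s : ZMod 2) : PPlus →ₗ[ℂ] PPlus :=
  (2⁻¹ : ℂ) • (LinearMap.id + (-1 : ℂ) ^ s.val • parityAut)

theorem proj_apply (s : ZMod 2) (A : PPlus) :
    proj s A = (2⁻¹ : ℂ) • (A + (-1 : ℂ) ^ s.val • parityAut A) := rfl

theorem proj_mem (s : ZMod 2) (A : PPlus) : proj s A ∈ ofParity s := by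
  rw [mem_ofParity, proj_apply]
  simp only [map_smul, map_add, parityAut_parityAut]
  obtain rfl | rfl := zmodTwo_cases s <;> simp [zmodTwo_val_one] <;> module

theorem proj_of_mem {s : ZMod 2} {A : PPlus} (h : A ∈ ofParity s) : proj s A = A := by
  rw [mem_ofParity] at h
  rw [proj_apply, h]
  obtain rfl | rfl := zmodTwo_cases s <;> simp [zmodTwo_val_one] <;> module

theorem proj_of_mem_add_one {s : ZMod 2} {A : PPlus} (h : A ∈ ofParity s) :
    proj (s + 1) A = 0 := by
  rw [mem_ofParity] at h
  rw [proj_apply, h]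
  obtain rfl | rfl := zmodTwo_cases s <;> simp [zmodTwo_val_one, zmodTwo_one_add_one]

theorem bracket_mem {i j : ZMod 2} {A B : PPlus} (hA : A ∈ ofParity i) (hB : B ∈ ofParity j) :
    bracket A B ∈ ofParity (i + j) := by
  rw [mem_ofParity] at *
  rw [parityAut_bracket, hA, hB]
  obtain rfl | rfl := zmodTwo_cases i <;> obtain rfl | rfl := zmodTwo_cases j <;>
    simp [zmodTwo_val_one, zmodTwo_one_add_one]

/-- Bracketing with a homogeneous element shifts parity, so it intertwines the parity projections.
-/
theorem proj_add_bracket {i : ZMod 2} {A : PPlus} (hA : A ∈ ofParity i) (s : ZMod 2) (B : PPlus) :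
    proj (i + s) (bracket A B) = bracket A (proj s B) := by
  rw [mem_ofParity] at hA
  rw [proj_apply, proj_apply, parityAut_bracket, hA]
  simp only [map_smul, map_add, LinearMap.smul_apply]
  obtain rfl | rfl := zmodTwo_cases i <;> obtain rfl | rfl := zmodTwo_cases s <;>
    simp [zmodTwo_val_one, zmodTwo_one_add_one]

theorem proj_tm (s : ZMod 2) (a : Symb) (w : Grass) :
    proj s (tm a w) = tm a ((2⁻¹ : ℂ) • (w + (-1 : ℂ) ^ s.val • Grass.inv w)) := by
  rw [proj_apply, parityAut_tm, tm_smul, tm_add, tm_smul]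

theorem inv_half_add (s : ZMod 2) (w : Grass) :
    Grass.inv ((2⁻¹ : ℂ) • (w + (-1 : ℂ) ^ s.val • Grass.inv w)) =
      (-1 : ℂ) ^ s.val • ((2⁻¹ : ℂ) • (w + (-1 : ℂ) ^ s.val • Grass.inv w)) := by
  simp only [map_smul, map_add, Grass.inv_inv]
  obtain rfl | rfl := zmodTwo_cases s <;> simp [zmodTwo_val_one] <;> module

theorem ofParity_induction {s : ZMod 2} {C : PPlus → Prop} (zero : C 0)
    (tm : ∀ a w, Grass.inv w = (-1 : ℂ) ^ s.val • w → C (tm a w))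
    (add : ∀ A B, C A → C B → C (A + B)) {A : PPlus} (hA : A ∈ ofParity s) : C A := by
  rw [← proj_of_mem hA]
  generalize A = B
  induction B using tm_induction with
  | zero => rw [map_zero]; exact zero
  | tm a w => rw [proj_tm]; exact tm _ _ (inv_half_add s w)
  | add A B hA hB => rw [map_add]; exact add _ _ hA hB

theorem bracket_antisymm {i j : ZMod 2} {A B : PPlus} (hA : A ∈ ofParity i) (hB : B ∈ ofParity j) :
    bracket A B = -(-1 : ℂ) ^ (i * j).val • bracket B A := by
  refine ofParity_induction (C := fun A => bracket A B = -(-1 : ℂ) ^ (i * j).val • bracket B A)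
    ?_ (fun a v hv => ?_) (fun A A' h h' => ?_) hA
  · simp
  · refine ofParity_induction (C := fun B =>
      bracket (tm a v) B = -(-1 : ℂ) ^ (i * j).val • bracket B (tm a v))
      ?_ (fun b w hw => ?_) (fun B B' h h' => ?_) hB
    · simp
    · rw [bracket_tm, bracket_tm, Grass.br_antisymm hv hw, Grass.mul_comm_of_parity hv hw,
        Symb.br_antisymm, mul_comm a b]
      simp only [tm_smul, neg_tm]
      module
    · rw [map_add, h, h', map_add, LinearMap.add_apply, smul_add]
  · rw [map_add, LinearMap.add_apply, h, h', map_add, smul_add]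

/-- The super Jacobi identity. -/
theorem bracket_jacobi {i j : ZMod 2} {A B : PPlus} (hA : A ∈ ofParity i) (hB : B ∈ ofParity j)
    (C : PPlus) : bracket A (bracket B C) =
      bracket (bracket A B) C + (-1 : ℂ) ^ (i * j).val • bracket B (bracket A C) := by
  refine ofParity_induction (C := fun A => bracket A (bracket B C) =
      bracket (bracket A B) C + (-1 : ℂ) ^ (i * j).val • bracket B (bracket A C))
    ?_ (fun a u hu => ?_) (fun A A' h h' => ?_) hA
  · simp
  · refine ofParity_induction (C := fun B => bracket (tm a u) (bracket B C) =
      bracket (bracket (tm a u) B) C + (-1 : ℂ) ^ (i * j).val • bracket B (bracket (tm a u) C))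
      ?_ (fun b v hv => ?_) (fun B B' h h' => ?_) hB
    · simp
    · induction C using tm_induction with
      | zero => simp
      | add C C' h h' => simp only [map_add, h, h', smul_add]; abel
      | tm c w =>
        simp only [bracket_tm, map_sub, LinearMap.sub_apply]
        -- All signs are powers of one `ε` with `ε² = 1`; the remaining identity is linear for each
        -- of its two values.
        have hε : (-1 : ℂ) ^ (i * j).val = 1 ∨ (-1 : ℂ) ^ (i * j).val = -1 :=
          neg_one_pow_eq_or ℂ _
        have hvu : v * (u * w) = (-1 : ℂ) ^ (i * j).val • (u * (v * w)) := by
          rw [← mul_assoc, Grass.mul_comm_of_parity hv hu, mul_comm j i, smul_mul_assoc, mul_assoc]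
        rw [Grass.br_jacobi hu hv, Grass.br_leibniz hu hv, Grass.br_leibniz hv hu,
          Grass.mul_br hu hv, hvu, Grass.br_antisymm hv hu, mul_comm j i, Symb.br_jacobi a b c]
        generalize (-1 : ℂ) ^ (i * j).val = ε at hε
        simp only [Symb.br_mul, Symb.mul_br, tm_add, tm_smul, add_tm, smul_mul_assoc,
          Symb.br_antisymm b a, neg_tm, neg_mul]
        rw [mul_left_comm b a c]
        simp only [mul_assoc]
        rcases hε with rfl | rfl <;> module
    · simp only [map_add, LinearMap.add_apply, h, h', smul_add]; abel
  · simp only [map_add, LinearMap.add_apply, h, h', smul_add]; abel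

theorem el_add (i : ℤ) (j : ℕ) (v w : Grass) : el i j (v + w) = el i j v + el i j w :=
  tm_add _ _ _

theorem el_neg (i : ℤ) (j : ℕ) (v : Grass) : el i j (-v) = -el i j v := tm_neg _ _

theorem el_zero (i : ℤ) (j : ℕ) : el i j 0 = 0 := tm_zero _

theorem el_smul (i : ℤ) (j : ℕ) (r : ℂ) (v : Grass) : el i j (r • v) = r • el i j v :=
  tm_smul _ _ _

theorem bracket_el (i k : ℤ) (j l : ℕ) (v w : Grass) :
    bracket (el i j v) (el k l w) =
      ((j : ℂ) * k - i * l) • el (i + k - 1) (j + l - 1) (v * w)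
        - el (i + k) (j + l) (Grass.br v w) := by
  simp only [el_eq_tm, bracket_tm, Symb.br, Symb.dt_single, Symb.dtau_single,
    AddMonoidAlgebra.single_mul_single, Prod.mk_add_mk, one_mul, mul_one]
  congr 1
  rw [← smul_tm]
  congr 1
  have e₁ : i + (k - 1) = i + k - 1 := by ring
  have e₂ : i - 1 + k = i + k - 1 := by ring
  rw [e₁, e₂, AddMonoidAlgebra.smul_single, smul_eq_mul, mul_one, AddMonoidAlgebra.single_sub]
  -- The exponents of `τ` use truncated subtraction; wherever truncation occurs, the coefficient is
  -- zero.
  rcases j with _ | j <;> rcases l with _ | l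
  · simp
  · simp
  · simp
  · have e₃ : j + 1 - 1 + (l + 1) = j + 1 + (l + 1) - 1 := by omega
    have e₄ : j + 1 + (l + 1 - 1) = j + 1 + (l + 1) - 1 := by omega
    rw [e₃, e₄]

end PPlus

theorem xi_zero : xi 0 = Grass.x 0 := rfl
theorem xi_one : xi 1 = Grass.x 1 := rfl
theorem eta_zero : eta 0 = Grass.x 2 := rfl
theorem eta_one : eta 1 = Grass.x 3 := rfl

/-! ### The multiplication table of `Γ_α` -/

namespace Gen

open Finsupp (single)

/-- The parity of the generators. -/
def parity : Gen → ZMod 2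
  | E1 | F1 | H1 | E2 | F2 | H2 | E3 | F3 | H3 => 0
  | _ => 1

/-- The coordinates of the bracket of two generators of `Γ_α`, listed in the order of the labels. -/
noncomputable def brCoord (α : ℂ) : Gen → Gen → Gen →₀ ℂ
  | E1, F1 => single H1 (-4)
  | E1, H1 => single E1 (-2)
  | E1, D1 => single T3 (-2)
  | E1, D2 => single T4 (-2)
  | E1, D3 => single T1 (-2)
  | E1, D4 => single T2 (-2)
  | F1, H1 => single F1 2
  | F1, T1 => single D3 2
  | F1, T2 => single D4 2
  | F1, T3 => single D1 2
  | F1, T4 => single D2 2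
  | H1, T1 => single T1 1
  | H1, T2 => single T2 1
  | H1, T3 => single T3 1
  | H1, T4 => single T4 1
  | H1, D1 => single D1 (-1)
  | H1, D2 => single D2 (-1)
  | H1, D3 => single D3 (-1)
  | H1, D4 => single D4 (-1)
  | E2, F2 => single H2 (-1)
  | E2, H2 => single E2 (-2)
  | E2, T1 => single T4 (-1)
  | E2, T2 => single T3 1
  | E2, D3 => single D2 (-1)
  | E2, D4 => single D1 1
  | F2, H2 => single F2 2
  | F2, T3 => single T2 (-1)
  | F2, T4 => single T1 1
  | F2, D1 => single D4 (-1)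
  | F2, D2 => single D3 1
  | H2, T1 => single T1 (-1)
  | H2, T2 => single T2 (-1)
  | H2, T3 => single T3 1
  | H2, T4 => single T4 1
  | H2, D1 => single D1 1
  | H2, D2 => single D2 1
  | H2, D3 => single D3 (-1)
  | H2, D4 => single D4 (-1)
  | E3, F3 => single H3 1
  | E3, H3 => single E3 (-2)
  | E3, T1 => single T2 (-1)
  | E3, T4 => single T3 1
  | E3, D2 => single D1 1
  | E3, D3 => single D4 (-1)
  | F3, H3 => single F3 2
  | F3, T2 => single T1 (-1)
  | F3, T3 => single T4 1
  | F3, D1 => single D2 1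
  | F3, D4 => single D3 (-1)
  | H3, T1 => single T1 (-1)
  | H3, T2 => single T2 1
  | H3, T3 => single T3 1
  | H3, T4 => single T4 (-1)
  | H3, D1 => single D1 1
  | H3, D2 => single D2 (-1)
  | H3, D3 => single D3 (-1)
  | H3, D4 => single D4 1
  | T1, T3 => single E1 1
  | T1, D1 => single H1 1 + single H2 ((1 + α) / 2) + single H3 ((1 - α) / 2)
  | T1, D2 => single F3 (1 - α)
  | T1, D4 => single F2 (-(1 + α))
  | T2, T4 => single E1 1
  | T2, D1 => single E3 (1 - α)
  | T2, D2 => single H1 1 + single H2 ((1 + α) / 2) + single H3 (-((1 - α) / 2))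
  | T2, D3 => single F2 (1 + α)
  | T3, D2 => single E2 (-(1 + α))
  | T3, D3 => single H1 1 + single H2 (-((1 + α) / 2)) + single H3 (-((1 - α) / 2))
  | T3, D4 => single E3 (-(1 - α))
  | T4, D1 => single E2 (1 + α)
  | T4, D3 => single F3 (-(1 - α))
  | T4, D4 => single H1 1 + single H2 (-((1 + α) / 2)) + single H3 ((1 - α) / 2)
  | D1, D3 => single F1 1
  | D2, D4 => single F1 1
  -- The default also catches pairs in reversed order, where it need not be the bracket; hence the
  -- hypothesis `g.ctorIdx ≤ h.ctorIdx` wherever the table is used.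
  | _, _ => 0

end Gen

set_option maxHeartbeats 4000000 in
theorem bracket_gen (α : ℂ) (g h : Gen) (hgh : g.ctorIdx ≤ h.ctorIdx) :
    bracket (gen α g) (gen α h) = Finsupp.linearCombination ℂ (gen α) (g.brCoord α h) := by
  cases g <;> cases h <;> first
    | exact absurd hgh (by decide)
    | (simp [gen, Gen.brCoord, bracket_el, xi_zero, xi_one, eta_zero, eta_one, mul_assoc,
        Grass.br_apply, Fin.sum_univ_four, Grass.grassD_x_mul, Grass.grassD_x, el_add,
        el_neg, el_zero, Grass.x_sq, Grass.x_sq_mul,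
        Grass.x_mul_x 1 0, Grass.x_mul_x 2 0, Grass.x_mul_x 3 0, Grass.x_mul_x 2 1,
        Grass.x_mul_x 3 1, Grass.x_mul_x 3 2, Grass.x_mul_x_mul 1 0, Grass.x_mul_x_mul 2 0,
        Grass.x_mul_x_mul 3 0, Grass.x_mul_x_mul 2 1, Grass.x_mul_x_mul 3 1,
        Grass.x_mul_x_mul 3 2] <;> try module)

/-! ### Coefficients, and the basis of `Γ_α` -/

namespace PPlus

/-- The coefficient of `t ^ i τ ^ j`. -/
noncomputable def coef (i : ℤ) (j : ℕ) : PPlus →ₗ[ℂ] Grass :=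
  Finsupp.lapply (i, j) ∘ₗ
    (TensorProduct.equivFinsuppOfBasisLeft (AddMonoidAlgebra.basis (ℤ × ℕ) ℂ)).toLinearMap

theorem coef_el (i k : ℤ) (j l : ℕ) (w : Grass) :
    coef i j (el k l w) = if k = i ∧ l = j then w else 0 := by
  refine (TensorProduct.equivFinsuppOfBasisLeft_apply_tmul_apply
    (AddMonoidAlgebra.basis (ℤ × ℕ) ℂ) (AddMonoidAlgebra.single (k, l) 1) w (i, j)).trans ?_
  simp [Finsupp.single_apply, AddMonoidAlgebra.basis, ite_smul]

theorem ext_coef {A B : PPlus} (h : ∀ i j, coef i j A = coef i j B) : A = B :=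
  (TensorProduct.equivFinsuppOfBasisLeft (AddMonoidAlgebra.basis (ℤ × ℕ) ℂ)).injective
    (Finsupp.ext fun x => h x.1 x.2)

theorem parityAut_el (i : ℤ) (j : ℕ) (w : Grass) :
    parityAut (el i j w) = el i j (Grass.inv w) := rfl

end PPlus

theorem gen_mem_ofParity (α : ℂ) (g : Gen) : gen α g ∈ ofParity g.parity := by
  rw [mem_ofParity]
  cases g <;>
    simp [gen, Gen.parity, parityAut_el, xi_zero, xi_one, eta_zero, eta_one, zmodTwo_val_one,
      el_neg] <;> try module

/-- A family of functionals dual to the generators of `Γ_α`. -/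
noncomputable def genDual : Gen → Module.Dual ℂ PPlus :=
  let ε : Grass →ₗ[ℂ] ℂ := ExteriorAlgebra.algebraMapInv.toLinearMap
  fun
  | .E1 => ε ∘ₗ coef 2 0
  | .F1 => ε ∘ₗ coef 0 2
  | .H1 => ε ∘ₗ coef 1 1
  | .E2 => ε ∘ₗ grassD 1 ∘ₗ grassD 0 ∘ₗ coef 0 0
  | .F2 => ε ∘ₗ grassD 3 ∘ₗ grassD 2 ∘ₗ coef 0 0
  | .H2 => (2⁻¹ : ℂ) • ε ∘ₗ (grassD 2 ∘ₗ grassD 0 + grassD 3 ∘ₗ grassD 1) ∘ₗ coef 0 0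
  | .E3 => ε ∘ₗ grassD 3 ∘ₗ grassD 0 ∘ₗ coef 0 0
  | .F3 => ε ∘ₗ grassD 2 ∘ₗ grassD 1 ∘ₗ coef 0 0
  | .H3 => (2⁻¹ : ℂ) • ε ∘ₗ (grassD 2 ∘ₗ grassD 0 - grassD 3 ∘ₗ grassD 1) ∘ₗ coef 0 0
  | .T1 => ε ∘ₗ grassD 2 ∘ₗ coef 1 0
  | .T2 => ε ∘ₗ grassD 3 ∘ₗ coef 1 0
  | .T3 => ε ∘ₗ grassD 0 ∘ₗ coef 1 0
  | .T4 => ε ∘ₗ grassD 1 ∘ₗ coef 1 0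
  | .D1 => ε ∘ₗ grassD 0 ∘ₗ coef 0 1
  | .D2 => ε ∘ₗ grassD 1 ∘ₗ coef 0 1
  | .D3 => ε ∘ₗ grassD 2 ∘ₗ coef 0 1
  | .D4 => ε ∘ₗ grassD 3 ∘ₗ coef 0 1

set_option maxHeartbeats 4000000 in
theorem genDual_gen (α : ℂ) (g h : Gen) : genDual g (gen α h) = if g = h then 1 else 0 := by
  cases g <;> cases h <;>
    simp [gen, genDual, coef_el, xi_zero, xi_one, eta_zero, eta_one, mul_assoc,
      Grass.grassD_x_mul, Grass.grassD_x] <;> norm_num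

theorem linearIndependent_gen (α : ℂ) : LinearIndependent ℂ (gen α) :=
  LinearIndependent.of_pairwise_dual_eq_zero_one (gen α) genDual
    (fun g h hgh => (genDual_gen α g h).trans (if_neg hgh))
    (fun g => (genDual_gen α g g).trans (if_pos rfl))

/-- The generators form a basis of `Γ_α`. -/
noncomputable def genBasis (α : ℂ) : Module.Basis Gen ℂ (Gam α) :=
  Module.Basis.span (linearIndependent_gen α)

theorem coe_genBasis (α : ℂ) (g : Gen) : (genBasis α g : PPlus) = gen α g :=
  congrArg Subtype.val (Module.Basis.span_apply (linearIndependent_gen α) g)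

theorem gen_mem_Gam (α : ℂ) (g : Gen) : gen α g ∈ Gam α := Submodule.subset_span ⟨g, rfl⟩

theorem bracket_gen_mem_Gam (α : ℂ) (g h : Gen) : bracket (gen α g) (gen α h) ∈ Gam α := by
  have key : ∀ g h : Gen, g.ctorIdx ≤ h.ctorIdx → bracket (gen α g) (gen α h) ∈ Gam α := by
    intro g h hgh
    rw [bracket_gen α g h hgh, Gam, Finsupp.mem_span_range_iff_exists_finsupp]
    exact ⟨_, rfl⟩
  rcases le_total g.ctorIdx h.ctorIdx with hgh | hgh
  · exact key g h hgh
  · rw [bracket_antisymm (gen_mem_ofParity α g) (gen_mem_ofParity α h)]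
    exact Submodule.smul_mem _ _ (key h g hgh)

theorem isSubsuperalgebra_Gam (α : ℂ) : IsSubsuperalgebra (Gam α) := by
  constructor
  · intro A hA
    induction hA using Submodule.span_induction with
    | mem A h =>
      obtain ⟨g, rfl⟩ := h
      rw [mem_ofParity.mp (gen_mem_ofParity α g)]
      exact Submodule.smul_mem _ _ (gen_mem_Gam α g)
    | zero => simp
    | add A B _ _ hA hB => rw [map_add]; exact add_mem hA hB
    | smul r A _ hA => rw [map_smul]; exact Submodule.smul_mem _ _ hA
  · intro A hA B hB
    induction hA using Submodule.span_induction with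
    | mem A h =>
      obtain ⟨g, rfl⟩ := h
      induction hB using Submodule.span_induction with
      | mem B h => obtain ⟨h, rfl⟩ := h; exact bracket_gen_mem_Gam α g h
      | zero => simp
      | add A B _ _ hA hB => rw [map_add]; exact add_mem hA hB
      | smul r A _ hA => rw [map_smul]; exact Submodule.smul_mem _ _ hA
    | zero => simp
    | add A B _ _ hA hB => rw [map_add]; exact add_mem hA hB
    | smul r A _ hA => rw [map_smul]; exact Submodule.smul_mem _ _ hA

/-! ### The outer derivation behind `θ₁` and `ρ₂` -/

namespace PPlus

/-- The even derivation `t⁻¹ ∂_τ` of `P⁺(4)`, the bracket with `log t`. -/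
noncomputable def logDer : PPlus →ₗ[ℂ] PPlus :=
  mul (el (-1) 0 1) ∘ₗ dtau

theorem logDer_tm (a : Symb) (w : Grass) :
    logDer (tm a w) = tm (AddMonoidAlgebra.single (-1, 0) 1 * symbDtau a) w := by
  rw [logDer, LinearMap.comp_apply, dtau_tm, el_eq_tm, mul_tm, one_mul]

theorem logDer_el (i : ℤ) (j : ℕ) (w : Grass) :
    logDer (el i j w) = (j : ℂ) • el (i - 1) (j - 1) w := by
  rw [el_eq_tm, logDer_tm, Symb.dtau_single, AddMonoidAlgebra.single_mul_single, el_eq_tm,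
    ← smul_tm, AddMonoidAlgebra.smul_single]
  congr 2
  · exact Prod.ext (neg_add_eq_sub 1 i) (zero_add _)
  · simp

theorem logDer_parityAut (A : PPlus) : logDer (parityAut A) = parityAut (logDer A) := by
  induction A using tm_induction with
  | zero => simp
  | add A B hA hB => simp only [map_add, hA, hB]
  | tm a w => simp only [parityAut_tm, logDer_tm]

theorem logDer_mem {s : ZMod 2} {A : PPlus} (h : A ∈ ofParity s) : logDer A ∈ ofParity s := by
  rw [mem_ofParity] at *
  rw [← logDer_parityAut, h, map_smul]

/-- `t⁻¹ ∂_τ` acts on the symbol factor alone, where it is a derivation of both the product (`h₂`)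
and the Poisson bracket (`h₁`). -/
theorem logDer_bracket (A B : PPlus) :
    logDer (bracket A B) = bracket (logDer A) B + bracket A (logDer B) := by
  induction A using tm_induction with
  | zero => simp
  | add A A' h h' => simp only [map_add, LinearMap.add_apply, h, h']; abel
  | tm a v =>
    induction B using tm_induction with
    | zero => simp
    | add B B' h h' => simp only [map_add, h, h']; abel
    | tm b w =>
      have h₁ : AddMonoidAlgebra.single (-1, 0) 1 * symbDtau (Symb.br a b) =
          Symb.br (AddMonoidAlgebra.single (-1, 0) 1 * symbDtau a) b +
            Symb.br a (AddMonoidAlgebra.single (-1, 0) 1 * symbDtau b) := by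
        simp only [Symb.br, map_sub, Symb.dt_mul, Symb.dtau_mul, Symb.dtau_dt, Symb.dtau_single,
          Nat.cast_zero, mul_zero, AddMonoidAlgebra.single_zero]
        ring
      have h₂ : AddMonoidAlgebra.single (-1, 0) 1 * symbDtau (a * b) =
          AddMonoidAlgebra.single (-1, 0) 1 * symbDtau a * b +
            a * (AddMonoidAlgebra.single (-1, 0) 1 * symbDtau b) := by
        rw [Symb.dtau_mul]; ring
      simp only [bracket_tm, map_sub, logDer_tm, h₁, h₂, add_tm]
      abel

end PPlus

/-- The terms carrying `α` contain no `τ`, so `θ₁` has the same values for all `α`. -/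
theorem logDer_gen (α : ℂ) (g : Gen) : logDer (gen α g) = theta1Val g := by
  cases g <;> simp [gen, theta1Val, logDer_el]

theorem logDer_theta1Val (g : Gen) : logDer (theta1Val g) = (2 : ℂ) • rho2Val g := by
  cases g <;> simp [theta1Val, rho2Val, logDer_el]

theorem logDer_rho2Val (g : Gen) : logDer (rho2Val g) = 0 := by
  cases g <;> simp [rho2Val, logDer_el]

/-! ### The adjoint actions of `t²`, `t τ` and `t xₖ` -/

namespace PPlus

theorem grassBr_one_left (w : Grass) : Grass.br 1 w = 0 := by simp [Grass.br_apply]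

theorem grassBr_one_right (w : Grass) : Grass.br w 1 = 0 := by simp [Grass.br_apply]

/-- The variable `xₖ₊₂` is conjugate to `xₖ`; this is the reason for the shifted index in
`Gen.ofFin`. -/
theorem grassBr_x (k : Fin 4) (w : Grass) : Grass.br (Grass.x (k + 2)) w = -grassD k w := by
  have hk : k + 2 + 2 = k := by revert k; decide
  rw [Grass.br_apply, Finset.sum_eq_single (k + 2)]
  · simp [Grass.grassD_x, hk]
  · intro l _ hl
    simp [Grass.grassD_x, hl]
  · simp

theorem bracket_tSq_el (k : ℤ) (l : ℕ) (w : Grass) :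
    bracket (el 2 0 1) (el k l w) = (-2 * l : ℂ) • el (k + 1) (l - 1) w := by
  rw [bracket_el, grassBr_one_left, el_zero, sub_zero, one_mul, zero_add]
  have e : 2 + k - 1 = k + 1 := by ring
  rw [e]
  congr 1
  push_cast
  ring

theorem bracket_tTau_el (k : ℤ) (l : ℕ) (w : Grass) :
    bracket (el 1 1 1) (el k l w) = ((k : ℂ) - l) • el k l w := by
  rw [bracket_el, grassBr_one_left, el_zero, sub_zero, one_mul, add_sub_cancel_left,
    Nat.add_sub_cancel_left]
  congr 1
  push_cast
  ring

theorem bracket_tX_el (k : Fin 4) (m : ℤ) (l : ℕ) (w : Grass) :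
    bracket (el 1 0 (Grass.x (k + 2))) (el m l w) =
      (-l : ℂ) • el m (l - 1) (Grass.x (k + 2) * w) + el (m + 1) l (grassD k w) := by
  rw [bracket_el, grassBr_x, el_neg, sub_neg_eq_add, add_sub_cancel_left, zero_add, add_comm 1 m]
  congr 2
  push_cast
  ring

theorem coef_bracket_tSq (i : ℤ) (j : ℕ) (A : PPlus) :
    coef (i + 1) j (bracket (el 2 0 1) A) = (-2 * (j + 1) : ℂ) • coef i (j + 1) A := by
  induction A using el_induction with
  | zero => simp
  | add A B hA hB => simp only [map_add, hA, hB, smul_add]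
  | el k l w =>
    rw [bracket_tSq_el, map_smul, coef_el, coef_el]
    rcases l with _ | l
    · simp
    · simp only [add_left_inj, Nat.add_sub_cancel]
      split_ifs with h
      · rw [h.2]; push_cast; rfl
      · simp

theorem coef_bracket_tTau (i : ℤ) (j : ℕ) (A : PPlus) :
    coef i j (bracket (el 1 1 1) A) = ((i : ℂ) - j) • coef i j A := by
  induction A using el_induction with
  | zero => simp
  | add A B hA hB => simp only [map_add, hA, hB, smul_add]
  | el k l w =>
    rw [bracket_tTau_el, map_smul, coef_el]
    split_ifs with h
    · rw [h.1, h.2]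
    · simp

theorem coef_bracket_tX (k : Fin 4) (i : ℤ) (A : PPlus) :
    coef (i + 1) 0 (bracket (el 1 0 (Grass.x (k + 2))) A) =
      grassD k (coef i 0 A) - Grass.x (k + 2) * coef (i + 1) 1 A := by
  induction A using el_induction with
  | zero => simp
  | add A B hA hB => simp only [map_add, hA, hB, mul_add]; abel
  | el m l w =>
    rw [bracket_tX_el, map_add, map_smul, coef_el, coef_el, coef_el, coef_el]
    rcases l with _ | _ | l
    · by_cases h : m = i <;> simp [h]
    · by_cases h : m = i + 1 <;> simp [h]
    · simp

theorem bracket_one (A : PPlus) : bracket A (el 0 0 1) = 0 := by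
  induction A using el_induction with
  | zero => simp
  | add A B hA hB => simp only [map_add, LinearMap.add_apply, hA, hB, add_zero]
  | el i j w => rw [bracket_el, grassBr_one_right, el_zero]; simp

theorem exists_bracket_tSq_eq (A : PPlus) : ∃ u, bracket (el 2 0 1) u = A := by
  induction A using el_induction with
  | zero => exact ⟨0, map_zero _⟩
  | add A B hA hB =>
    obtain ⟨u, rfl⟩ := hA
    obtain ⟨v, rfl⟩ := hB
    exact ⟨u + v, map_add _ _ _⟩
  | el i j w =>
    -- The preimage is an antiderivative in `τ`, whose degree raises by one; characteristic zero
    -- allows the division.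
    have hj : (-2 * ((j + 1 : ℕ) : ℂ)) ≠ 0 := by simp [Nat.cast_add_one_ne_zero]
    refine ⟨(-2 * ((j + 1 : ℕ) : ℂ))⁻¹ • el (i - 1) (j + 1) w, ?_⟩
    rw [map_smul, bracket_tSq_el, smul_smul, inv_mul_cancel₀ hj, one_smul, sub_add_cancel,
      Nat.add_sub_cancel]

theorem coef_succ_eq_zero {A : PPlus} (h : bracket (el 2 0 1) A = 0) (i : ℤ) (j : ℕ) :
    coef i (j + 1) A = 0 := by
  have := coef_bracket_tSq i j A
  rw [h, map_zero, eq_comm, smul_eq_zero] at this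
  exact this.resolve_left (by simp [Nat.cast_add_one_ne_zero])

/-- On elements free of `τ`, `t τ` acts on the `tᵏ` component by `k`, so only the component `k = 0`
obstructs. The solution `u` is again free of `τ`, so its coboundary does not disturb the value at
`t²`. -/
theorem exists_bracket_tTau_eq {A : PPlus} (hA : bracket (el 2 0 1) A = 0) :
    ∃ u, bracket (el 2 0 1) u = 0 ∧ bracket (el 1 1 1) u = A - el 0 0 (coef 0 0 A) := by
  have key : ∀ B : PPlus, ∃ u, bracket (el 2 0 1) u = 0 ∧
      ∀ i, coef i 0 (bracket (el 1 1 1) u) = if i = 0 then 0 else coef i 0 B := by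
    intro B
    induction B using el_induction with
    | zero => exact ⟨0, by simp⟩
    | add B C hB hC =>
      obtain ⟨u, hu, hu'⟩ := hB
      obtain ⟨v, hv, hv'⟩ := hC
      refine ⟨u + v, by rw [map_add, hu, hv, add_zero], fun i => ?_⟩
      rw [map_add, map_add, hu', hv', map_add]
      split_ifs <;> simp
    | el k l w =>
      by_cases h : l = 0 ∧ k ≠ 0
      · obtain ⟨rfl, hk⟩ := h
        refine ⟨(k : ℂ)⁻¹ • el k 0 w, by simp [bracket_tSq_el], fun i => ?_⟩
        rw [map_smul, bracket_tTau_el, smul_smul, Nat.cast_zero, sub_zero,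
          inv_mul_cancel₀ (Int.cast_ne_zero.mpr hk), one_smul, coef_el]
        by_cases hi : i = 0
        · rw [if_pos hi, if_neg (by rw [hi]; exact fun h => hk h.1)]
        · rw [if_neg hi]
      · refine ⟨0, by simp, fun i => ?_⟩
        rw [map_zero, map_zero, coef_el]
        split_ifs with h₁ h₂
        · rfl
        · exact absurd ⟨h₂.2, h₂.1 ▸ h₁⟩ h
        · rfl
  obtain ⟨u, hu, hu'⟩ := key A
  refine ⟨u, hu, ext_coef fun i j => ?_⟩
  rcases j with _ | j
  · rw [hu', map_sub, coef_el]
    by_cases hi : i = 0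
    · subst hi; simp
    · simp [hi, Ne.symm hi]
  · rw [coef_bracket_tTau, coef_succ_eq_zero hu, map_sub, coef_succ_eq_zero hA, coef_el]
    simp

/-- The elements annihilated by `t²` and `t ξᵢ`, `t ηᵢ` that are of weight `n` for `t τ`. -/
theorem eq_smul_el_of_weight {A : PPlus} {n : ℤ} (h₁ : bracket (el 2 0 1) A = 0)
    (h₂ : ∀ k : Fin 4, bracket (el 1 0 (Grass.x (k + 2))) A = 0)
    (h₃ : bracket (el 1 1 1) A = (n : ℂ) • A) : ∃ κ : ℂ, A = κ • el n 0 1 := by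
  have hD : ∀ k, grassD k (coef n 0 A) = 0 := by
    intro k
    have := coef_bracket_tX k n A
    rw [h₂, map_zero, coef_succ_eq_zero h₁ (n + 1) 0, mul_zero, sub_zero] at this
    exact this.symm
  refine ⟨ExteriorAlgebra.algebraMapInv (coef n 0 A), ext_coef fun i j => ?_⟩
  rw [map_smul, coef_el]
  rcases j with _ | j
  · by_cases hi : n = i
    · subst hi
      rw [if_pos ⟨rfl, rfl⟩, ← Algebra.algebraMap_eq_smul_one]
      exact Grass.eq_algebraMap_of_grassD_eq_zero hD
    · rw [if_neg (fun h => hi h.1), smul_zero]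
      have := coef_bracket_tTau i 0 A
      rw [h₃, map_smul, Nat.cast_zero, sub_zero, ← sub_eq_zero, ← sub_smul, smul_eq_zero] at this
      exact this.resolve_left (sub_ne_zero.mpr (by exact_mod_cast hi))
  · rw [coef_succ_eq_zero h₁, if_neg (by simp), smul_zero]

end PPlus

/-! ### Normalizing a cocycle on the generators -/

/-- A family indexed by the generators of `Γ_α` satisfies the (untwisted) cocycle identity. -/
def IsGenCocycle (α : ℂ) (f : Gen → PPlus) : Prop :=
  ∀ g h : Gen, g.ctorIdx ≤ h.ctorIdx →
    bracket (gen α g) (f h) - (-1 : ℂ) ^ (g.parity * h.parity).val • bracket (gen α h) (f g) =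
      Finsupp.linearCombination ℂ f (g.brCoord α h)

theorem linearCombination_comp {ι M N : Type*} [AddCommGroup M] [Module ℂ M] [AddCommGroup N]
    [Module ℂ N] (φ : M →ₗ[ℂ] N) (f : ι → M) (v : ι →₀ ℂ) :
    Finsupp.linearCombination ℂ (fun i => φ (f i)) v = φ (Finsupp.linearCombination ℂ f v) :=
  (Finsupp.apply_linearCombination ℂ φ f v).symm

namespace IsGenCocycle

variable {α : ℂ} {f f' : Gen → PPlus}

theorem sub (hf : IsGenCocycle α f) (hf' : IsGenCocycle α f') :
    IsGenCocycle α (fun g => f g - f' g) := by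
  intro g h hgh
  have e : Finsupp.linearCombination ℂ (fun g => f g - f' g) (g.brCoord α h) =
      Finsupp.linearCombination ℂ f (g.brCoord α h) -
        Finsupp.linearCombination ℂ f' (g.brCoord α h) := by
    simp only [Finsupp.linearCombination_apply, smul_sub, Finsupp.sum_sub]
  rw [e, ← hf g h hgh, ← hf' g h hgh, map_sub, map_sub, smul_sub]
  abel

theorem smul (hf : IsGenCocycle α f) (r : ℂ) : IsGenCocycle α (fun g => r • f g) := by
  intro g h hgh
  have e : ∀ v : Gen →₀ ℂ, Finsupp.linearCombination ℂ (fun g => r • f g) v =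
      r • Finsupp.linearCombination ℂ f v := fun v => by
    simp only [Finsupp.linearCombination_apply, Finsupp.smul_sum, smul_comm r]
  rw [e, ← hf g h hgh]
  simp only [map_smul]
  module

/-- This is the Jacobi identity, with no parity assumed on `u`. -/
theorem coboundary (α : ℂ) (u : PPlus) : IsGenCocycle α (fun g => bracket (gen α g) u) := by
  intro g h hgh
  have e : Finsupp.linearCombination ℂ (fun g => bracket (gen α g) u) (g.brCoord α h) =
      bracket (Finsupp.linearCombination ℂ (gen α) (g.brCoord α h)) u :=
    linearCombination_comp (bracket.flip u) (gen α) _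
  rw [e, ← bracket_gen α g h hgh,
    bracket_jacobi (gen_mem_ofParity α g) (gen_mem_ofParity α h), add_sub_cancel_right]

theorem theta1 (α : ℂ) : IsGenCocycle α theta1Val := by
  intro g h hgh
  have e : theta1Val = fun g => logDer (gen α g) := funext fun g => (logDer_gen α g).symm
  have hg := gen_mem_ofParity α g
  have hh := gen_mem_ofParity α h
  rw [e, linearCombination_comp logDer, ← bracket_gen α g h hgh, logDer_bracket,
    bracket_antisymm (logDer_mem hg) hh]
  module

end IsGenCocycle

/-- The label of the generator `t xₖ₊₂`. -/
def Gen.ofFin : Fin 4 → Gen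
  | 0 => .T1
  | 1 => .T2
  | 2 => .T3
  | 3 => .T4

theorem gen_ofFin (α : ℂ) (k : Fin 4) : gen α (Gen.ofFin k) = el 1 0 (Grass.x (k + 2)) := by
  fin_cases k <;> rfl

namespace IsGenCocycle

variable {α : ℂ} {f : Gen → PPlus}

theorem bracket_right (hf : IsGenCocycle α f) {g h : Gen} (hgh : g.ctorIdx ≤ h.ctorIdx)
    (hg : f g = 0) :
    bracket (gen α g) (f h) = Finsupp.linearCombination ℂ f (g.brCoord α h) := by
  rw [← hf g h hgh, hg, map_zero, smul_zero, sub_zero]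

theorem bracket_left (hf : IsGenCocycle α f) {g h : Gen} (hgh : g.ctorIdx ≤ h.ctorIdx)
    (hh : f h = 0) (h0 : Finsupp.linearCombination ℂ f (g.brCoord α h) = 0) :
    bracket (gen α h) (f g) = 0 := by
  have := hf g h hgh
  rw [hh, map_zero, zero_sub, h0, neg_eq_zero, smul_eq_zero] at this
  exact this.resolve_left (pow_ne_zero _ (by norm_num))

theorem linearCombination_single_eq_zero {k : Gen} (hk : f k = 0) (r : ℂ) :
    Finsupp.linearCombination ℂ f (Finsupp.single k r) = 0 := by
  rw [Finsupp.linearCombination_single, hk, smul_zero]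

theorem eq_smul_el (hf : IsGenCocycle α f) (hE : f .E1 = 0) (hH : f .H1 = 0) {g : Gen} (n : ℤ)
    (h2 : 2 ≤ g.ctorIdx)
    (h₁ : Finsupp.linearCombination ℂ f (Gen.brCoord α .E1 g) = 0)
    (h₂ : ∀ k, bracket (gen α (Gen.ofFin k)) (f g) = 0)
    (h₃ : Finsupp.linearCombination ℂ f (Gen.brCoord α .H1 g) = (n : ℂ) • f g) :
    ∃ κ : ℂ, f g = κ • el n 0 1 :=
  eq_smul_el_of_weight ((hf.bracket_right (Nat.zero_le _) hE).trans h₁)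
    (fun k => by rw [← gen_ofFin α]; exact h₂ k) ((hf.bracket_right (g := .H1) h2 hH).trans h₃)

/-- The cocycle vanishes on the span of the products of two odd variables. -/
theorem eq_zero_of_odd_mul_odd (hf : IsGenCocycle α f) (hE : f .E1 = 0) (hH : f .H1 = 0)
    (hT : ∀ k, f (Gen.ofFin k) = 0) (g : Gen) (h3 : 3 ≤ g.ctorIdx) (h8 : g.ctorIdx ≤ 8) :
    f g = 0 := by
  have hT1 : f .T1 = 0 := hT 0
  have hT2 : f .T2 = 0 := hT 1
  have hT3 : f .T3 = 0 := hT 2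
  have hT4 : f .T4 = 0 := hT 3
  -- These generators commute with `t²` and `t τ`, and map the span of the `t xₖ` to itself, so the
  -- value has weight `0` and is a scalar.
  have hconst : ∀ g : Gen, 3 ≤ g.ctorIdx → g.ctorIdx ≤ 8 → ∃ κ : ℂ, f g = κ • el 0 0 1 := by
    intro g h3 h8
    refine hf.eq_smul_el hE hH 0 (le_trans (by norm_num) h3) ?_ (fun k => ?_) ?_
    · cases g <;> first
        | exact absurd h3 (by decide)
        | exact absurd h8 (by decide)
        | exact map_zero _
    · refine hf.bracket_left (h8.trans ?_) (hT k) ?_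
      · revert k; decide
      · cases g <;> first
          | exact absurd h3 (by decide)
          | exact absurd h8 (by decide)
          | (fin_cases k <;> simp [Gen.brCoord, Gen.ofFin, hT1, hT2, hT3, hT4])
    · rw [Int.cast_zero, zero_smul]
      cases g <;> first
        | exact absurd h3 (by decide)
        | exact absurd h8 (by decide)
        | exact map_zero _
  have hcomm : ∀ (g h k : Gen) (r : ℂ), 3 ≤ g.ctorIdx → g.ctorIdx ≤ h.ctorIdx → h.ctorIdx ≤ 8 →
      g.brCoord α h = Finsupp.single k r → r ≠ 0 → f k = 0 := by
    intro g h k r h3 hgh h8 he hr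
    obtain ⟨κ, hκ⟩ := hconst g h3 (hgh.trans h8)
    obtain ⟨κ', hκ'⟩ := hconst h (h3.trans hgh) h8
    have := hf g h hgh
    rw [hκ, hκ', map_smul, map_smul, bracket_one, bracket_one, smul_zero, smul_zero, smul_zero,
      sub_zero, he, Finsupp.linearCombination_single, eq_comm, smul_eq_zero] at this
    exact this.resolve_left hr
  cases g
  case E2 => exact hcomm .E2 .H2 _ (-2) (by decide) (by decide) (by decide) rfl (by norm_num)
  case F2 => exact hcomm .F2 .H2 _ 2 (by decide) (by decide) (by decide) rfl (by norm_num)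
  case H2 => exact hcomm .E2 .F2 _ (-1) (by decide) (by decide) (by decide) rfl (by norm_num)
  case E3 => exact hcomm .E3 .H3 _ (-2) (by decide) (by decide) (by decide) rfl (by norm_num)
  case F3 => exact hcomm .F3 .H3 _ 2 (by decide) (by decide) (by decide) rfl (by norm_num)
  case H3 => exact hcomm .E3 .F3 _ 1 (by decide) (by decide) (by decide) rfl (by norm_num)
  all_goals first
    | exact absurd h3 (by decide)
    | exact absurd h8 (by decide)

theorem bracket_H2_el (α : ℂ) (n : ℤ) : bracket (gen α .H2) (el n 0 1) = 0 := by
  simp only [gen, map_add, LinearMap.add_apply, bracket_el, grassBr_one_right, el_zero]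
  simp

theorem eq_zero_of_tau_mul_odd (hf : IsGenCocycle α f) (hE : f .E1 = 0) (hH : f .H1 = 0)
    (hT : ∀ k, f (Gen.ofFin k) = 0) (g : Gen) (h13 : 13 ≤ g.ctorIdx) : f g = 0 := by
  have hso := hf.eq_zero_of_odd_mul_odd hE hH hT
  have hT1 : f .T1 = 0 := hT 0
  have hT2 : f .T2 = 0 := hT 1
  have hT3 : f .T3 = 0 := hT 2
  have hT4 : f .T4 = 0 := hT 3
  have hE2 : f .E2 = 0 := hso .E2 (by decide) (by decide)
  have hF2 : f .F2 = 0 := hso .F2 (by decide) (by decide)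
  have hH2 : f .H2 = 0 := hso .H2 (by decide) (by decide)
  have hE3 : f .E3 = 0 := hso .E3 (by decide) (by decide)
  have hF3 : f .F3 = 0 := hso .F3 (by decide) (by decide)
  have hH3 : f .H3 = 0 := hso .H3 (by decide) (by decide)
  obtain ⟨κ, hκ⟩ : ∃ κ : ℂ, f g = κ • el (-1) 0 1 := by
    refine hf.eq_smul_el hE hH (-1) (le_trans (by norm_num) h13) ?_ (fun k => ?_) ?_
    · cases g <;> first
        | exact absurd h13 (by decide)
        | simp [Gen.brCoord, hT1, hT2, hT3, hT4]
    · refine (hf.bracket_right (le_trans ?_ h13) (hT k)).trans ?_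
      · revert k; decide
      · cases g <;> first
          | exact absurd h13 (by decide)
          | (fin_cases k <;>
              simp [Gen.brCoord, Gen.ofFin, hH, hE2, hF2, hH2, hE3, hF3, hH3])
    · cases g <;> first
        | exact absurd h13 (by decide)
        | simp [Gen.brCoord]
  -- `H2` has eigenvalue `±1` on `g` but annihilates `t⁻¹`, so the scalar must vanish.
  have h2 := hf.bracket_right (g := .H2) (h := g) (le_trans (by decide) h13)
    hH2
  have h2' : ∃ r : ℂ, r ≠ 0 ∧ Gen.brCoord α .H2 g = Finsupp.single g r := by
    cases g
    case D1 => exact ⟨1, one_ne_zero, rfl⟩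
    case D2 => exact ⟨1, one_ne_zero, rfl⟩
    case D3 => exact ⟨-1, neg_ne_zero.mpr one_ne_zero, rfl⟩
    case D4 => exact ⟨-1, neg_ne_zero.mpr one_ne_zero, rfl⟩
    all_goals exact absurd h13 (by decide)
  obtain ⟨r, hr, he⟩ := h2'
  rw [he, Finsupp.linearCombination_single, hκ, map_smul, bracket_H2_el, smul_zero, ← hκ, eq_comm,
    smul_eq_zero] at h2
  exact h2.resolve_left hr

theorem eq_zero (hf : IsGenCocycle α f) (hE : f .E1 = 0) (hH : f .H1 = 0)
    (hT : ∀ k, f (Gen.ofFin k) = 0) (g : Gen) : f g = 0 := by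
  have hD := hf.eq_zero_of_tau_mul_odd hE hH hT
  have hF : f .F1 = 0 := by
    obtain ⟨κ, hκ⟩ : ∃ κ : ℂ, f .F1 = κ • el (-2) 0 1 := by
      refine eq_smul_el_of_weight (n := -2)
        ((hf.bracket_right (g := .E1) (by decide) hE).trans
          (linearCombination_single_eq_zero hH _)) (fun k => ?_) ?_
      · rw [← gen_ofFin α]
        refine hf.bracket_left ?_ (hT k) ?_
        · revert k; decide
        · fin_cases k <;> exact linearCombination_single_eq_zero (hD _ (by decide)) _
      · have h := hf .F1 .H1 (by decide)
        have h' : Finsupp.linearCombination ℂ f (Gen.brCoord α .F1 .H1) = (2 : ℂ) • f .F1 :=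
          Finsupp.linearCombination_single ℂ _ _
        rw [hH, map_zero, zero_sub, h', neg_eq_iff_eq_neg] at h
        simpa [Gen.parity, gen] using h
    -- As `F1` and `D1` commute, `{D1, κ t⁻²} = 0`; its `t⁻³ ξ₁` coefficient is `-2 κ`.
    have h := hf.bracket_left (g := .F1) (h := .D1) (by decide) (hD _ (by decide)) (map_zero _)
    rw [hκ, map_smul] at h
    have h' := congrArg (fun A => grassD 0 (coef (-3) 0 A)) h
    simp only [gen, map_add, LinearMap.add_apply, map_smul, LinearMap.smul_apply, bracket_el,
      grassBr_one_right, el_zero, map_sub, coef_el] at h'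
    simp [xi_zero, Grass.grassD_x] at h'
    rw [hκ, h', zero_smul]
  cases g
  case E1 => exact hE
  case F1 => exact hF
  case H1 => exact hH
  case T1 => exact hT 0
  case T2 => exact hT 1
  case T3 => exact hT 2
  case T4 => exact hT 3
  all_goals first
    | exact hD _ (by decide)
    | exact hf.eq_zero_of_odd_mul_odd hE hH hT _ (by decide) (by decide)

theorem exists_eq (hf : IsGenCocycle α f) :
    ∃ (u : PPlus) (κ : ℂ), ∀ g, f g = bracket (gen α g) u + κ • theta1Val g := by
  obtain ⟨u₁, hu₁⟩ := exists_bracket_tSq_eq (f .E1)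
  have hf₁ := hf.sub (coboundary α u₁)
  set f₁ : Gen → PPlus := fun g => f g - bracket (gen α g) u₁ with hf₁_def
  have hE₁ : f₁ .E1 = 0 := sub_eq_zero.mpr hu₁.symm
  have hH₁ : bracket (el 2 0 1) (f₁ .H1) = 0 :=
    (hf₁.bracket_right (g := .E1) (by decide) hE₁).trans (linearCombination_single_eq_zero hE₁ _)
  obtain ⟨u₂, hu₂, hu₂'⟩ := exists_bracket_tTau_eq hH₁
  have hf₂ := hf₁.sub (coboundary α u₂)
  set f₂ : Gen → PPlus := fun g => f₁ g - bracket (gen α g) u₂ with hf₂_def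
  have hE₂ : f₂ .E1 = 0 := by
    change f₁ .E1 - bracket (el 2 0 1) u₂ = 0
    rw [hE₁, hu₂, sub_zero]
  set w := coef 0 0 (f₁ .H1) with hw
  have hH₂ : f₂ .H1 = el 0 0 w := by
    change f₁ .H1 - bracket (el 1 1 1) u₂ = _
    rw [hu₂', sub_sub_cancel]
  have hT₂ : ∀ k, bracket (el 2 0 1) (f₂ (Gen.ofFin k)) = 0 := fun k =>
    (hf₂.bracket_right (g := .E1) (Nat.zero_le _) hE₂).trans
      (by fin_cases k <;> exact map_zero _)
  have hHT : ∀ k, bracket (el 1 1 1) (f₂ (Gen.ofFin k)) - el 1 0 (grassD k w) =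
      f₂ (Gen.ofFin k) := by
    intro k
    have h := hf₂ .H1 (Gen.ofFin k) (by revert k; decide)
    have h' : Finsupp.linearCombination ℂ f₂ (Gen.brCoord α .H1 (Gen.ofFin k)) =
        f₂ (Gen.ofFin k) := by
      fin_cases k <;> exact (Finsupp.linearCombination_single ℂ _ _).trans (one_smul _ _)
    rw [h', hH₂, gen_ofFin, bracket_tX_el] at h
    simpa [Gen.parity, gen] using h
  -- In degree `t¹` the operator `ad (t τ) - 1` vanishes, which isolates `∂ₖ w`.
  have hw0 : ∀ k, grassD k w = 0 := by
    intro k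
    have h := congrArg (coef 1 0) (hHT k)
    rw [map_sub, coef_bracket_tTau, coef_el] at h
    simpa using h
  have hTel : ∀ k, f₂ (Gen.ofFin k) = el 1 0 (coef 1 0 (f₂ (Gen.ofFin k))) := by
    intro k
    refine ext_coef fun i j => ?_
    rw [coef_el]
    rcases j with _ | j
    · by_cases hi : 1 = i
      · subst hi; simp
      · have h := congrArg (coef i 0) (hHT k)
        rw [map_sub, coef_bracket_tTau, hw0, el_zero, map_zero, sub_zero, Nat.cast_zero, sub_zero,
          ← sub_eq_zero] at h
        nth_rewrite 2 [← one_smul ℂ (coef i 0 (f₂ (Gen.ofFin k)))] at h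
        rw [← sub_smul, smul_eq_zero] at h
        rw [if_neg (fun h => hi h.1)]
        exact h.resolve_left (sub_ne_zero.mpr (by exact_mod_cast Ne.symm hi))
    · rw [coef_succ_eq_zero (hT₂ k), if_neg (by simp)]
  set κ : ℂ := ExteriorAlgebra.algebraMapInv w with hκ
  have hwκ : w = κ • (1 : Grass) := by
    rw [← Algebra.algebraMap_eq_smul_one]
    exact Grass.eq_algebraMap_of_grassD_eq_zero hw0
  set v : Fin 4 → Grass := fun k => coef 1 0 (f₂ (Gen.ofFin k)) with hv
  have hf₃ := hf₂.sub ((theta1 α).smul κ)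
  set f₃ : Gen → PPlus := fun g => f₂ g - κ • theta1Val g with hf₃_def
  have hE₃ : f₃ .E1 = 0 := by
    change f₂ .E1 - κ • (0 : PPlus) = 0
    rw [hE₂, smul_zero, sub_zero]
  have hH₃ : f₃ .H1 = 0 := by
    change f₂ .H1 - κ • el 0 0 1 = 0
    rw [hH₂, hwκ, el_smul, sub_self]
  have hT₃ : ∀ k, f₃ (Gen.ofFin k) = el 1 0 (v k) := by
    intro k
    have h0 : theta1Val (Gen.ofFin k) = 0 := by fin_cases k <;> rfl
    change f₂ (Gen.ofFin k) - κ • theta1Val (Gen.ofFin k) = _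
    rw [h0, smul_zero, sub_zero]
    exact hTel k
  -- The bracket of two elements `t xₖ` is a multiple of `t²`, where the cocycle is already zero.
  have hvv : ∀ k l : Fin 4, k ≤ l → grassD k (v l) + grassD l (v k) = 0 := by
    intro k l hkl
    have h := hf₃ (Gen.ofFin k) (Gen.ofFin l) (by revert k l; decide)
    have h' : Finsupp.linearCombination ℂ f₃ (Gen.brCoord α (Gen.ofFin k) (Gen.ofFin l)) = 0 := by
      fin_cases k <;> fin_cases l <;> simp [Gen.brCoord, Gen.ofFin, hE₃]
    have hp : (-1 : ℂ) ^ ((Gen.ofFin k).parity * (Gen.ofFin l).parity).val = -1 := by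
      have : ((Gen.ofFin k).parity * (Gen.ofFin l).parity).val = 1 := by
        clear h h'; revert k l; decide
      rw [this, pow_one]
    rw [h', hp, gen_ofFin, gen_ofFin, hT₃, hT₃, bracket_tX_el, bracket_tX_el] at h
    have h2 := congrArg (coef 2 0) h
    simpa [coef_el] using h2
  obtain ⟨u₃, hu₃⟩ := Grass.exists_grassD_eq (v := v) (fun k l => by
    rcases le_total k l with h | h
    · exact hvv k l h
    · rw [add_comm]; exact hvv l k h)
  -- An element of `Λ(4)` commutes with `t²` and `t τ`, so the earlier normalizations survive.
  have hf₄ := hf₃.sub (coboundary α (el 0 0 u₃))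
  have h0 := hf₄.eq_zero
    (by change f₃ .E1 - bracket (el 2 0 1) (el 0 0 u₃) = 0; simp [hE₃, bracket_tSq_el])
    (by change f₃ .H1 - bracket (el 1 1 1) (el 0 0 u₃) = 0; simp [hH₃, bracket_tTau_el])
    (fun k => by
      rw [gen_ofFin, bracket_tX_el, hT₃, hu₃]
      simp)
  refine ⟨u₁ + u₂ + el 0 0 u₃, κ, fun g => ?_⟩
  have h := h0 g
  change f g - bracket (gen α g) u₁ - bracket (gen α g) u₂ - κ • theta1Val g
    - bracket (gen α g) (el 0 0 u₃) = 0 at h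
  rw [map_add, map_add, ← sub_eq_zero, ← h]
  abel

end IsGenCocycle

/-! ### From generators to cohomology classes -/

theorem constr_theta1Val (α : ℂ) :
    (genBasis α).constr ℂ theta1Val = logDer ∘ₗ (Gam α).subtype := by
  refine (genBasis α).ext fun g => ?_
  rw [Module.Basis.constr_basis, LinearMap.comp_apply, Submodule.subtype_apply, coe_genBasis,
    logDer_gen]

theorem constr_rho2Val (α : ℂ) :
    (genBasis α).constr ℂ rho2Val = (2⁻¹ : ℂ) • (logDer ∘ₗ logDer ∘ₗ (Gam α).subtype) := by
  refine (genBasis α).ext fun g => ?_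
  rw [Module.Basis.constr_basis, LinearMap.smul_apply, LinearMap.comp_apply, LinearMap.comp_apply,
    Submodule.subtype_apply, coe_genBasis, logDer_gen, logDer_theta1Val, smul_smul]
  norm_num

theorem logDer_constr_rho2Val (α : ℂ) (X : Gam α) :
    logDer ((genBasis α).constr ℂ rho2Val X) = 0 := by
  have h : logDer ∘ₗ (genBasis α).constr ℂ rho2Val = 0 := by
    refine (genBasis α).ext fun g => ?_
    rw [LinearMap.comp_apply, Module.Basis.constr_basis, logDer_rho2Val, LinearMap.zero_apply]
  exact LinearMap.congr_fun h X

theorem theta1_mem_cocyclesOfParity (α : ℂ) :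
    (genBasis α).constr ℂ theta1Val ∈ cocyclesOfParity (isSubsuperalgebra_Gam α) 0 := by
  rw [constr_theta1Val]
  refine ⟨fun i X hX => ?_, fun i j X Y hX hY => ?_⟩
  · rw [add_zero]
    exact logDer_mem hX
  · simp only [LinearMap.comp_apply, Submodule.subtype_apply, subBracket, logDer_bracket, mul_zero,
      add_zero, ZMod.val_zero, pow_zero, one_smul]
    rw [bracket_antisymm (logDer_mem hX) hY, mul_comm j i]
    module

section Twist

variable {L : Submodule ℂ PPlus}

/-- The `s`-th power of the parity automorphism of a subsuperalgebra. -/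
noncomputable def parityTwist (hL : IsSubsuperalgebra L) (s : ZMod 2) : L →ₗ[ℂ] L :=
  if s = 0 then LinearMap.id else parityAut.restrict hL.1

theorem parityTwist_apply (hL : IsSubsuperalgebra L) (s : ZMod 2) {i : ZMod 2} {X : L}
    (hX : (X : PPlus) ∈ ofParity i) : parityTwist hL s X = (-1 : ℂ) ^ (i * s).val • X := by
  obtain rfl | rfl := zmodTwo_cases s
  · simp [parityTwist]
  · rw [parityTwist, if_neg (by decide), mul_one]
    exact Subtype.ext (mem_ofParity.mp hX)

end Twist

theorem subBracket_genBasis (α : ℂ) (g h : Gen) (hgh : g.ctorIdx ≤ h.ctorIdx) :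
    subBracket (isSubsuperalgebra_Gam α) (genBasis α g) (genBasis α h) =
      Finsupp.linearCombination ℂ (genBasis α) (g.brCoord α h) := by
  refine Subtype.ext ?_
  have e : gen α = fun g => (Gam α).subtype (genBasis α g) :=
    funext fun g => (coe_genBasis α g).symm
  change bracket (genBasis α g : PPlus) (genBasis α h : PPlus) = (Gam α).subtype _
  rw [coe_genBasis, coe_genBasis, bracket_gen α g h hgh, ← linearCombination_comp, ← e]

/-- Replacing `c X` by `(-1) ^ (p(X) s) c X` turns the cocycle identity of parity `s` into the one
of parity `0`. -/
theorem isGenCocycle_of_mem {α : ℂ} {s : ZMod 2} {c : Gam α →ₗ[ℂ] PPlus}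
    (hc : c ∈ cocyclesOfParity (isSubsuperalgebra_Gam α) s) :
    IsGenCocycle α (fun g => c (parityTwist (isSubsuperalgebra_Gam α) s (genBasis α g))) := by
  intro g h hgh
  have hp : ∀ g, (genBasis α g : PPlus) ∈ ofParity g.parity := fun g => by
    rw [coe_genBasis]; exact gen_mem_ofParity α g
  have hs : ((subBracket (isSubsuperalgebra_Gam α) (genBasis α g) (genBasis α h) : Gam α) :
      PPlus) ∈ ofParity (g.parity + h.parity) := bracket_mem (hp g) (hp h)
  have e : Finsupp.linearCombination ℂ
      (fun g => c (parityTwist (isSubsuperalgebra_Gam α) s (genBasis α g))) (g.brCoord α h) =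
      (c ∘ₗ parityTwist (isSubsuperalgebra_Gam α) s)
        (Finsupp.linearCombination ℂ (genBasis α) (g.brCoord α h)) :=
    linearCombination_comp (c ∘ₗ parityTwist (isSubsuperalgebra_Gam α) s) (genBasis α) _
  have hcc := hc.2 _ _ _ _ (hp g) (hp h)
  rw [sub_eq_zero] at hcc
  beta_reduce
  rw [e, ← subBracket_genBasis α g h hgh, LinearMap.comp_apply, parityTwist_apply _ s hs,
    parityTwist_apply _ s (hp g), parityTwist_apply _ s (hp h)]
  simp only [map_smul]
  rw [← hcc, coe_genBasis, coe_genBasis]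
  generalize g.parity = i
  generalize h.parity = j
  obtain rfl | rfl := zmodTwo_cases s <;> obtain rfl | rfl := zmodTwo_cases i <;>
    obtain rfl | rfl := zmodTwo_cases j <;> simp [zmodTwo_val_one, zmodTwo_one_add_one] <;> abel

/-- The normalization gives `u` and `κ` without parity control. Projecting to parity `p(X) + s`
replaces `u` by its part of parity `s`; it keeps the even map `D` if `s = 0` and kills it if `s =
1`. -/
theorem exists_sub_smul_theta1_mem {α : ℂ} {s : ZMod 2} {c : Gam α →ₗ[ℂ] PPlus}
    (hc : c ∈ cocyclesOfParity (isSubsuperalgebra_Gam α) s) :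
    ∃ κ : ℂ, c - κ • (genBasis α).constr ℂ theta1Val ∈ coboundaries (Gam α) := by
  obtain ⟨u, κ, h⟩ := (isGenCocycle_of_mem hc).exists_eq
  have hlin : c ∘ₗ parityTwist (isSubsuperalgebra_Gam α) s =
      bracket.flip u ∘ₗ (Gam α).subtype + κ • (genBasis α).constr ℂ theta1Val := by
    refine (genBasis α).ext fun g => ?_
    rw [LinearMap.comp_apply, h g, LinearMap.add_apply, LinearMap.smul_apply,
      Module.Basis.constr_basis, LinearMap.comp_apply, Submodule.subtype_apply, coe_genBasis,
      LinearMap.flip_apply]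
  have key : ∀ (i : ZMod 2) (X : Gam α), (X : PPlus) ∈ ofParity i →
      (-1 : ℂ) ^ (i * s).val • c X =
        bracket X (proj s u) + κ • proj (i + s) (logDer (X : PPlus)) := by
    intro i X hX
    have h := LinearMap.congr_fun hlin X
    rw [LinearMap.comp_apply, parityTwist_apply _ s hX, map_smul, constr_theta1Val] at h
    have h' := congrArg (proj (i + s)) h
    rw [map_smul, proj_of_mem (hc.1 i X hX)] at h'
    rw [h', ← proj_add_bracket hX, ← map_smul, ← map_add]
    rfl
  obtain rfl | rfl := zmodTwo_cases s
  · refine ⟨κ, Submodule.mem_sup_left ⟨proj 0 u, proj_mem _ _, fun i X hX => ?_⟩⟩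
    have h := key i X hX
    rw [add_zero, proj_of_mem (logDer_mem hX)] at h
    rw [mul_zero, ZMod.val_zero, pow_zero, one_smul] at h ⊢
    rw [LinearMap.sub_apply, h, constr_theta1Val, LinearMap.smul_apply]
    exact add_sub_cancel_right _ _
  · refine ⟨0, Submodule.mem_sup_right ⟨proj 1 u, proj_mem _ _, fun i X hX => ?_⟩⟩
    have h := key i X hX
    rw [proj_of_mem_add_one (logDer_mem hX), smul_zero, add_zero] at h
    rw [zero_smul, sub_zero, ← h, smul_smul, ← mul_pow]
    norm_num

theorem theta1_notMem_coboundaries (α : ℂ) :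
    (genBasis α).constr ℂ theta1Val ∉ coboundaries (Gam α) := by
  intro hθ
  obtain ⟨c₀, ⟨u₀, -, h₀⟩, c₁, ⟨u₁, -, h₁⟩, h⟩ := Submodule.mem_sup.mp hθ
  have key : ∀ g : Gen, g.parity = 0 → theta1Val g = bracket (gen α g) (u₀ + u₁) := by
    intro g hg
    have hp : (genBasis α g : PPlus) ∈ ofParity 0 := by
      rw [coe_genBasis, ← hg]; exact gen_mem_ofParity α g
    have h' := LinearMap.congr_fun h (genBasis α g)
    rw [Module.Basis.constr_basis, LinearMap.add_apply, h₀ 0 _ hp, h₁ 0 _ hp, coe_genBasis] at h'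
    rw [← h', map_add]
    simp
  -- `ad (t τ)` multiplies the coefficient of `t⁰ τ⁰` by `0`, while `θ₁ (t τ) = 1`.
  have hH := congrArg (coef 0 0) (key .H1 rfl)
  change coef 0 0 (el 0 0 1) = coef 0 0 (bracket (el 1 1 1) (u₀ + u₁)) at hH
  rw [coef_bracket_tTau, coef_el] at hH
  simp at hH

theorem isFormalDeformation_quadraticSeries (α : ℂ) :
    IsFormalDeformation (isSubsuperalgebra_Gam α)
      (quadraticSeries (Gam α).subtype ((genBasis α).constr ℂ theta1Val)
        ((genBasis α).constr ℂ rho2Val)) := by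
  set θ := (genBasis α).constr ℂ theta1Val with hθ
  set ρ := (genBasis α).constr ℂ rho2Val with hρ
  have h₀ : ∀ X : Gam α, logDer (X : PPlus) = θ X := fun X => by rw [hθ, constr_theta1Val]; rfl
  have h₁ : ∀ X : Gam α, logDer (θ X) = (2 : ℂ) • ρ X := fun X => by
    rw [← h₀, hρ, constr_rho2Val, LinearMap.smul_apply, smul_smul]
    norm_num
  have h₂ : ∀ X : Gam α, logDer (ρ X) = 0 := logDer_constr_rho2Val α
  refine ⟨rfl, fun k => ?_, fun X Y n => ?_⟩
  · match k with
    | 0 => exact fun i X hX => by rw [add_zero]; exact hX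
    | 1 => exact (theta1_mem_cocyclesOfParity α).1
    | 2 =>
      intro i X hX
      change ρ X ∈ _
      rw [add_zero, hρ, constr_rho2Val]
      exact Submodule.smul_mem _ _ (logDer_mem (logDer_mem hX))
    | _ + 3 => exact zero_mem _
  -- The coefficients of `β, …, β⁴` come from applying `D` repeatedly to the bracket, with `D θ₁ = 2
  -- ρ₂` and `D ρ₂ = 0`; the factors `2`, `3`, `4` are then divided out.
  · have e₁ : θ (subBracket (isSubsuperalgebra_Gam α) X Y) =
        bracket (θ X) Y + bracket X (θ Y) := by
      rw [← h₀, ← h₀, ← h₀]; exact logDer_bracket _ _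
    have e₂ : ρ (subBracket (isSubsuperalgebra_Gam α) X Y) =
        bracket (ρ X) Y + bracket (θ X) (θ Y) + bracket X (ρ Y) := by
      have h := congrArg logDer e₁
      simp only [map_add, logDer_bracket, h₀, h₁, map_smul, LinearMap.smul_apply] at h
      have h' := congrArg ((2⁻¹ : ℂ) • ·) h
      simp only [smul_smul] at h'
      norm_num at h'
      rw [h']
      module
    have e₃ : bracket (ρ X) (θ Y) + bracket (θ X) (ρ Y) = 0 := by
      have h := congrArg logDer e₂
      simp only [map_add, logDer_bracket, h₀, h₁, h₂, map_smul, LinearMap.smul_apply, map_zero,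
        LinearMap.zero_apply] at h
      have h' : (3 : ℂ) • (bracket (ρ X) (θ Y) + bracket (θ X) (ρ Y)) = 0 := by
        rw [h]; module
      exact (smul_eq_zero.mp h').resolve_left (by norm_num)
    have e₄ : bracket (ρ X) (ρ Y) = 0 := by
      have h := congrArg logDer e₃
      simp only [map_add, logDer_bracket, h₁, h₂, map_smul, LinearMap.smul_apply, map_zero,
        LinearMap.zero_apply] at h
      have h' : (4 : ℂ) • bracket (ρ X) (ρ Y) = 0 := by
        rw [← h]; module
      exact (smul_eq_zero.mp h').resolve_left (by norm_num)
    match n with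
    | 0 => simp [quadraticSeries, subBracket]
    | 1 =>
      rw [Finset.Nat.sum_antidiagonal_eq_sum_range_succ_mk]
      simp only [Finset.sum_range_succ, Finset.sum_range_zero, quadraticSeries]
      rw [e₁, zero_add, add_comm]
      rfl
    | 2 =>
      rw [Finset.Nat.sum_antidiagonal_eq_sum_range_succ_mk]
      simp only [Finset.sum_range_succ, Finset.sum_range_zero, quadraticSeries]
      rw [e₂, zero_add]
      simp only [Submodule.subtype_apply]
      abel
    | 3 =>
      rw [Finset.Nat.sum_antidiagonal_eq_sum_range_succ_mk]
      simp only [Finset.sum_range_succ, Finset.sum_range_zero, quadraticSeries]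
      simpa [add_comm] using e₃.symm
    | 4 =>
      rw [Finset.Nat.sum_antidiagonal_eq_sum_range_succ_mk]
      simp only [Finset.sum_range_succ, Finset.sum_range_zero, quadraticSeries]
      simpa using e₄.symm
    | n + 5 =>
      have hz : ∀ m, 3 ≤ m → quadraticSeries (Gam α).subtype θ ρ m = 0 := by
        intro m hm
        obtain ⟨m, rfl⟩ := Nat.exists_eq_add_of_le' hm
        rfl
      rw [hz _ (by omega), LinearMap.zero_apply, Finset.sum_eq_zero]
      intro p hp
      rw [Finset.HasAntidiagonal.mem_antidiagonal] at hp
      rcases le_or_gt 3 p.1 with h | h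
      · rw [hz _ h]; simp
      · rw [hz p.2 (by omega)]; simp

/-- The basis `b` is determined by its values; `θ₁` and `ρ₂` are the linear maps on `Γ_α` with the
prescribed values on it. -/
theorem theorem4p3 (α : ℂ) :
    ∃ (hΓ : IsSubsuperalgebra (Gam α)) (b : Module.Basis Gen ℂ (Gam α)),
      (∀ g, (b g : PPlus) = gen α g) ∧
      ∃ hθ : b.constr ℂ theta1Val ∈ cocycles hΓ,
        Module.finrank ℂ (H1 hΓ) = 1 ∧
        Submodule.span ℂ {H1.mk hΓ (b.constr ℂ theta1Val) hθ} = ⊤ ∧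
        IsFormalDeformation hΓ
          (quadraticSeries (Gam α).subtype (b.constr ℂ theta1Val) (b.constr ℂ rho2Val)) := by
  have hθ : (genBasis α).constr ℂ theta1Val ∈ cocycles (isSubsuperalgebra_Gam α) :=
    Submodule.mem_sup_left (theta1_mem_cocyclesOfParity α)
  have hne : H1.mk (isSubsuperalgebra_Gam α) _ hθ ≠ 0 := fun h =>
    theta1_notMem_coboundaries α ((Submodule.Quotient.mk_eq_zero
      ((coboundaries (Gam α)).submoduleOf (cocycles (isSubsuperalgebra_Gam α)))).mp h)
  have hspan : Submodule.span ℂ {H1.mk (isSubsuperalgebra_Gam α) _ hθ} = ⊤ := by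
    refine (Submodule.eq_top_iff').mpr fun x => ?_
    obtain ⟨⟨c, hc⟩, rfl⟩ := Submodule.Quotient.mk_surjective _ x
    obtain ⟨c₀, hc₀, c₁, hc₁, rfl⟩ := Submodule.mem_sup.mp hc
    obtain ⟨κ₀, h₀⟩ := exists_sub_smul_theta1_mem hc₀
    obtain ⟨κ₁, h₁⟩ := exists_sub_smul_theta1_mem hc₁
    refine Submodule.mem_span_singleton.mpr ⟨κ₀ + κ₁, ?_⟩
    rw [H1.mk, ← Submodule.Quotient.mk_smul, eq_comm, Submodule.Quotient.eq]
    change c₀ + c₁ - (κ₀ + κ₁) • (genBasis α).constr ℂ theta1Val ∈ coboundaries (Gam α)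
    convert add_mem h₀ h₁ using 1
    module
  exact ⟨isSubsuperalgebra_Gam α, genBasis α, coe_genBasis α, hθ,
    (finrank_eq_one_iff_of_nonzero _ hne).mpr hspan, hspan, isFormalDeformation_quadraticSeries α⟩
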